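/- Let $Q_n=[-\tfrac12,\tfrac12]^n$ and, for $v\in\mathbb{R}^n\setminus\{0\}$, let $\sigma(v)=\mathrm{vol}_{n-1}(Q_n\cap v^\perp)$. A unit vector $v\in S^{n-1}$ is called a critical direction (and $Q_n\cap v^\perp$ a critical central section) if it is a critical point of the restriction of $\sigma$ to $S^{n-1}$. A vector $v$ and the section $Q_n\cap v^\perp$ are called diagonal if $v$ is parallel to the main diagonal of a $k$-dimensional face of $Q_n$ for some $1\le k\le n$, i.e. if $v$ is a non-zero multiple of a vector that has $k$ coordinates equal to $\pm1$ and all others equal to $0$. Theorem. For every $n\ge 4$ there exists a non-diagonal critical central section of $Q_n$ whose normal vector has only non-zero coordinates. More precisely, for $a\in\big(\tfrac1{\sqrt n},\tfrac1{\sqrt2}\big)$ put $b=b(a)=\sqrt{\frac{1-2a^2}{n-2}}$, let $v(a)=(a,a,b,\dots,b)\in S^{n-1}$, and let $$F_{n,2}(a)=\frac{1}{\pi(1-a^2)}\int_{-\infty}^{\infty}\mathrm{sinc}^{\,n-2}(bt)\,\mathrm{sinc}(at)\cos(at)\,dt-\frac{1}{\pi(1-b^2)}\int_{-\infty}^{\infty}\mathrm{sinc}^{\,n-3}(bt)\,\mathrm{sinc}^{2}(at)\cos(bt)\,dt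 ,$$ where $\mathrm{sinc}\,x=\frac{\sin x}{x}$ for $x\neq0$ and $\mathrm{sinc}\,0=1$. Then there is $\xi_n\in\big(\tfrac1{\sqrt n},\tfrac1{\sqrt2}\big)$ with $F_{n,2}(\xi_n)=0$ such that $v(\xi_n)$ is a critical direction, is not diagonal, and has no zero coordinate. -/

import Mathlib

open scoped MeasureTheory

noncomputable section

namespace CubeSections

/-- The centered unit cube `Q_n = [-1/2, 1/2]^n` in Euclidean space. -/
def cube (n : ℕ) : Set (EuclideanSpace ℝ (Fin n)) :=
  {x | ∀ i, x i ∈ Set.Icc (-(1 / 2) : ℝ) (1 / 2)}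

/-- The central section `Q_n ∩ v^⊥`. -/
def centralSection {n : ℕ} (v : EuclideanSpace ℝ (Fin n)) : Set (EuclideanSpace ℝ (Fin n)) :=
  cube n ∩ ((Submodule.span ℝ {v})ᗮ : Set (EuclideanSpace ℝ (Fin n)))

/-- The central section function `σ(v) = vol_{n-1}(Q_n ∩ v^⊥)` (for `v ≠ 0`). The volume is
the `(n-1)`-dimensional Hausdorff measure, normalized to agree with Lebesgue measure on
`(n-1)`-dimensional Euclidean spaces. -/
def sectionVolume {n : ℕ} (v : EuclideanSpace ℝ (Fin n)) : ℝ :=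
  (μHE[n - 1] (centralSection v)).toReal

/-- `v` is a critical direction: it is a unit vector and a critical point of the restriction of
`σ` to `S^{n-1}`, that is, this restriction is differentiable at `v` and its differential vanishes
on the tangent space `v^⊥` of the sphere. -/
def IsCriticalDirection {n : ℕ} (v : EuclideanSpace ℝ (Fin n)) : Prop :=
  v ∈ Metric.sphere (0 : EuclideanSpace ℝ (Fin n)) 1 ∧
    ∃ D : EuclideanSpace ℝ (Fin n) →L[ℝ] ℝ,
      HasFDerivWithinAt sectionVolume D (Metric.sphere 0 1) v ∧
        ∀ w ∈ (Submodule.span ℝ {v})ᗮ, D w = 0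

/-- `p` is a vertex of the cube `Q_n`. -/
def IsVertex {n : ℕ} (p : EuclideanSpace ℝ (Fin n)) : Prop :=
  ∀ i, p i = 1 / 2 ∨ p i = -(1 / 2)

/-- `v` is parallel to the main diagonal of a `k`-dimensional face of `Q_n`. Such a diagonal joins
two vertices `p`, `q` of the cube which differ in exactly `k` coordinates (the free coordinates
of the face). -/
def IsKDiagonal {n : ℕ} (k : ℕ) (v : EuclideanSpace ℝ (Fin n)) : Prop :=
  ∃ p q : EuclideanSpace ℝ (Fin n), IsVertex p ∧ IsVertex q ∧ {i | p i ≠ q i}.ncard = k ∧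
    ∃ c : ℝ, c ≠ 0 ∧ v = c • (q - p)

/-- `v` (equivalently, the section with normal vector `v`) is diagonal. -/
def IsDiagonal {n : ℕ} (v : EuclideanSpace ℝ (Fin n)) : Prop :=
  ∃ k : ℕ, 1 ≤ k ∧ k ≤ n ∧ IsKDiagonal k v

/-- `b_{n,k}(a) = √((1 - k a²) / (n - k))`. -/
def bCoord (n k : ℕ) (a : ℝ) : ℝ :=
  √((1 - (k : ℝ) * a ^ 2) / ((n : ℝ) - (k : ℝ)))

/-- `v_{n,k}(a) = (a, …, a, b, …, b)` with `k` coordinates `a` and `n - k` coordinates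
`b = b_{n,k}(a)`. -/
def twoValued (n k : ℕ) (a : ℝ) : EuclideanSpace ℝ (Fin n) :=
  WithLp.toLp 2 (fun i : Fin n => if (i : ℕ) < k then a else bCoord n k a)

/-- The function `F_{n,k}` (for `2 ≤ k ≤ n - 2`). -/
def F (n k : ℕ) (a : ℝ) : ℝ :=
  1 / (Real.pi * (1 - a ^ 2)) *
      (∫ t : ℝ, Real.sinc (bCoord n k a * t) ^ (n - k) * Real.sinc (a * t) ^ (k - 1) *
        Real.cos (a * t)) -
    1 / (Real.pi * (1 - bCoord n k a ^ 2)) *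
      (∫ t : ℝ, Real.sinc (bCoord n k a * t) ^ (n - k - 1) * Real.sinc (a * t) ^ k *
        Real.cos (bCoord n k a * t))

end CubeSections

end

open scoped Topology

namespace CubeSections

open Real MeasureTheory Filter Set

/-! ### The cardinal sine -/

/-! For a unit vector without zero coordinates, Fourier inversion gives `σ(v) = (1/π) ∫ ∏ sinc(vᵢ t)
dt` (`sectionVolume_eq`). Differentiating under the integral, criticality on the sphere follows from
the equations `∫ cos(vᵢ t) ∏_{j ≠ i} sinc(vⱼ t) dt = (1 - vᵢ²) ∫ ∏ sinc(vⱼ t) dt`, one per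
coordinate (`isCriticalDirection_of_cosSincProdIntegral`). For `(a, a, b, …, b)` only two of them
are distinct, and homogeneity (`euler_relation`) derives the second from the first. So it suffices
to find a stationary point of the volume inside the one-parameter family; both terms of `F` then
have the same value.

Put `m = n - 2` and let the direction be proportional to `(x, x, 1, …, 1)`. At `x = 1` this is the
main diagonal, which is stationary; as `x → ∞` the rescaled volume `familyVolume` tends to `√2 π`,
the value of `(1, 1, 0, …, 0)`. The value at `x = 1` is below this limit (`familyVolume_one_lt`),
yet `x = 1` is a strict local maximum within the family (`hasDerivAt_slopeNumerator_one`). The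
volume first falls and must later rise, so it is stationary at some `x > 1`
(`exists_slopeNumerator_eq_zero`).

Both inequalities concern the moments `J_k = ∫ sinc^k`. The bound `√n J_n < √2 π` comes from a
Gaussian majorant on `[0, π]` and a power tail (`sqrt_mul_moment_lt`). The local maximum is
equivalent to `(k+3) J_{k+2} < (k+2) J_k` (`moment_gap`): integration by parts writes the difference
as `(k+2) ∫ sinc^k w` with a weight `w` that is nonnegative off the origin. Even `k` is then
immediate, for odd `k ≥ 5` the main lobe outweighs the tail, and `k = 3` is computed exactly. -/

lemma mul_sinc (x : ℝ) : x * sinc x = sin x := by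
  by_cases hx : x = 0
  · simp [hx]
  · rw [sinc_of_ne_zero hx]; field_simp

lemma differentiable_sinc : Differentiable ℝ sinc := by
  intro x
  rw [sinc_eq_dslope]
  by_cases hx : x = 0
  · obtain ⟨p, hp⟩ := (analyticAt_sin (x := (0 : ℝ)))
    rw [hx]
    exact hp.has_fpower_series_dslope_fslope.analyticAt.differentiableAt
  · exact (differentiableAt_dslope_of_ne hx).2 differentiable_sin.differentiableAt

lemma hasDerivAt_sinc (x : ℝ) : HasDerivAt sinc (deriv sinc x) x :=
  (differentiable_sinc x).hasDerivAt

/-- Differentiating `x sinc x = sin x` avoids any case distinction at the origin. All later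
integrations by parts rest on this identity. -/
lemma mul_deriv_sinc (x : ℝ) : x * deriv sinc x = cos x - sinc x := by
  have h := (hasDerivAt_id x).mul (hasDerivAt_sinc x)
  have h2 : (id * sinc : ℝ → ℝ) = sin := by ext y; simp [mul_sinc]
  rw [h2] at h
  have := h.unique (hasDerivAt_sin x)
  simp at this
  linarith

lemma abs_mul_deriv_sinc_le (x : ℝ) : |x * deriv sinc x| ≤ 2 := by
  rw [mul_deriv_sinc]
  have h1 := abs_le.1 (abs_sinc_le_one x)
  have h2 := abs_le.1 (abs_cos_le_one x)
  exact abs_le.2 ⟨by linarith, by linarith⟩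

lemma sinc_sq_le (x : ℝ) : sinc x ^ 2 ≤ 2 * (1 + x ^ 2)⁻¹ := by
  have h1 : sinc x ^ 2 ≤ 1 := by
    rw [← sq_abs]; exact pow_le_one₀ (abs_nonneg _) (abs_sinc_le_one x)
  have h2 : x ^ 2 * sinc x ^ 2 ≤ 1 := by
    rw [← mul_pow, mul_sinc]; exact sin_sq_le_one x
  rw [← div_eq_mul_inv, le_div_iff₀ (by positivity)]
  nlinarith

lemma abs_sinc_pow_le {m : ℕ} (hm : 2 ≤ m) (x : ℝ) : |sinc x| ^ m ≤ 2 * (1 + x ^ 2)⁻¹ := by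
  refine (pow_le_pow_of_le_one (abs_nonneg _) (abs_sinc_le_one x) hm).trans ?_
  rw [sq_abs]; exact sinc_sq_le x

lemma integrable_mul_sinc_pow {g : ℝ → ℝ} (hg : Continuous g) {C : ℝ} (hC : ∀ t, |g t| ≤ C)
    {m : ℕ} (hm : 2 ≤ m) : Integrable fun t => g t * sinc t ^ m := by
  refine (integrable_inv_one_add_sq.const_mul (C * 2)).mono'
    (Continuous.aestronglyMeasurable (by fun_prop)) (ae_of_all _ fun t => ?_)
  rw [norm_mul, norm_pow, norm_eq_abs, norm_eq_abs, mul_assoc]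
  exact mul_le_mul (hC t) (abs_sinc_pow_le hm t) (by positivity) ((abs_nonneg _).trans (hC t))

lemma integrable_sinc_pow {m : ℕ} (hm : 2 ≤ m) : Integrable fun t => sinc t ^ m := by
  simpa using integrable_mul_sinc_pow (g := fun _ => 1) continuous_const (C := 1) (by simp) hm

/-! ### The integral of `sinc ^ 2` -/

/-- Explicit antiderivatives on both sides of the kink at `0`; the `1/a` terms cancel and the rest
is a half-angle formula. -/
lemma fourier_triangle (ξ : ℝ) (hξ : ξ ≠ 0) :
    FourierTransform.fourier (fun x : ℝ => ((max 0 (1 - |x|) : ℝ) : ℂ)) ξ =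
      ((sinc (π * ξ) ^ 2 : ℝ) : ℂ) := by
  set a : ℂ := ((-2 * π * ξ : ℝ) : ℂ) * Complex.I with ha
  have ha0 : a ≠ 0 := by
    rw [ha]; refine mul_ne_zero ?_ Complex.I_ne_zero
    rw [Complex.ofReal_ne_zero]; exact mul_ne_zero (by simp [pi_ne_zero]) hξ
  rw [Real.fourier_eq']
  have hexp (x : ℝ) : HasDerivAt (fun x : ℝ => Complex.exp (a * x)) (a * Complex.exp (a * x)) x := by
    have := ((hasDerivAt_id (x : ℂ)).const_mul a).cexp.comp_ofReal
    simpa [mul_comm] using this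
  have h1 : (∫ x : ℝ, Complex.exp (↑(-2 * π * inner ℝ x ξ) * Complex.I) •
        ((max 0 (1 - |x|) : ℝ) : ℂ)) =
      ∫ x in (-1 : ℝ)..1, Complex.exp (a * x) * ((1 - |x| : ℝ) : ℂ) := by
    rw [intervalIntegral.integral_of_le (by norm_num), ← integral_indicator measurableSet_Ioc]
    congr 1
    ext x
    have e : (↑(-2 * π * inner ℝ x ξ) * Complex.I : ℂ) = a * x := by
      simp [ha]; ring
    rw [e, indicator_apply, smul_eq_mul]
    split_ifs with h
    · rw [max_eq_right]; linarith [abs_le.2 ⟨h.1.le, h.2⟩]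
    · rw [max_eq_left]
      · simp
      · by_contra hh
        push Not at hh
        have := abs_lt.1 (show |x| < 1 by linarith)
        exact h ⟨this.1, this.2.le⟩
  have hcont : Continuous fun x : ℝ => Complex.exp (a * x) * ((1 - |x| : ℝ) : ℂ) := by fun_prop
  have h2 : ∫ x in (0 : ℝ)..1, Complex.exp (a * x) * ((1 - |x| : ℝ) : ℂ) =
      Complex.exp a / a ^ 2 - 1 / a - 1 / a ^ 2 := by
    have : ∫ x in (0 : ℝ)..1, Complex.exp (a * x) * ((1 - |x| : ℝ) : ℂ) =
        ∫ x in (0 : ℝ)..1, Complex.exp (a * x) * (1 - x) := by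
      refine intervalIntegral.integral_congr fun x hx => ?_
      rw [uIcc_of_le zero_le_one] at hx
      simp [abs_of_nonneg hx.1]
    rw [this, intervalIntegral.integral_eq_sub_of_hasDerivAt
      (f := fun x : ℝ => Complex.exp (a * x) * ((1 - x) / a + 1 / a ^ 2))]
    · simp; field_simp; ring
    · intro x _
      have h := (hexp x).mul ((((hasDerivAt_id x).ofReal_comp.const_sub 1).div_const a).add_const
        (1 / a ^ 2))
      convert! h using 1
      simp; field_simp; ring
    · exact Continuous.intervalIntegrable (by fun_prop) _ _
  have h3 : ∫ x in (-1 : ℝ)..0, Complex.exp (a * x) * ((1 - |x| : ℝ) : ℂ) =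
      Complex.exp (-a) / a ^ 2 + 1 / a - 1 / a ^ 2 := by
    have : ∫ x in (-1 : ℝ)..0, Complex.exp (a * x) * ((1 - |x| : ℝ) : ℂ) =
        ∫ x in (-1 : ℝ)..0, Complex.exp (a * x) * (1 + x) := by
      refine intervalIntegral.integral_congr fun x hx => ?_
      rw [uIcc_of_le (by norm_num)] at hx
      simp [abs_of_nonpos hx.2]
    rw [this, intervalIntegral.integral_eq_sub_of_hasDerivAt
      (f := fun x : ℝ => Complex.exp (a * x) * ((1 + x) / a - 1 / a ^ 2))]
    · simp; field_simp; ring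
    · intro x _
      have h := (hexp x).mul ((((hasDerivAt_id x).ofReal_comp.const_add 1).div_const a).sub_const
        (1 / a ^ 2))
      convert! h using 1
      simp; field_simp; ring
    · exact Continuous.intervalIntegrable (by fun_prop) _ _
  rw [h1, ← intervalIntegral.integral_add_adjacent_intervals (hcont.intervalIntegrable (-1) 0)
    (hcont.intervalIntegrable 0 1), h2, h3]
  have h4 : Complex.exp a + Complex.exp (-a) = ((2 - 4 * sin (π * ξ) ^ 2 : ℝ) : ℂ) := by
    have := Complex.two_cos ((-2 * π * ξ : ℝ) : ℂ)
    have e : (2 - 4 * sin (π * ξ) ^ 2 : ℝ) = 2 * cos (-2 * π * ξ) := by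
      rw [show -2 * π * ξ = -(2 * (π * ξ)) by ring, cos_neg, cos_two_mul, cos_sq']; ring
    rw [e, Complex.ofReal_mul, Complex.ofReal_cos, Complex.ofReal_ofNat, this, ha]
    congr 2; ring
  have h5 : a ^ 2 = ((-(4 * (π * ξ) ^ 2) : ℝ) : ℂ) := by
    rw [ha, mul_pow, Complex.I_sq, ← Complex.ofReal_pow]; push_cast; ring
  have h6 : Complex.exp (-a) / a ^ 2 + 1 / a - 1 / a ^ 2 +
      (Complex.exp a / a ^ 2 - 1 / a - 1 / a ^ 2) =
      (Complex.exp a + Complex.exp (-a) - 2) / a ^ 2 := by ring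
  rw [h6, h4, h5, sinc_of_ne_zero (mul_ne_zero pi_ne_zero hξ)]
  have h7 : π * ξ ≠ 0 := mul_ne_zero pi_ne_zero hξ
  norm_cast
  field_simp
  ring

/-- Fourier inversion of the hat function at `0`, where it equals `1`. -/
lemma integral_sinc_sq : ∫ t, sinc t ^ 2 = π := by
  set f : ℝ → ℂ := fun x : ℝ => ((max 0 (1 - |x|) : ℝ) : ℂ) with hf
  have hc : Continuous f := by fun_prop
  have hsupp : HasCompactSupport f := by
    refine HasCompactSupport.of_support_subset_isCompact (isCompact_Icc (a := (-1 : ℝ)) (b := 1)) ?_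
    intro x hx
    by_contra h
    refine hx ?_
    have : 1 < |x| := by
      by_contra h'
      exact h (abs_le.1 (not_lt.1 h'))
    simp only [hf, Complex.ofReal_eq_zero]
    exact max_eq_left (by linarith)
  have hint : Integrable f := hc.integrable_of_hasCompactSupport hsupp
  have hae : FourierTransform.fourier f =ᵐ[volume] fun ξ => ((sinc (π * ξ) ^ 2 : ℝ) : ℂ) := by
    filter_upwards [compl_mem_ae_iff.2 (measure_singleton (0 : ℝ))] with ξ hξ
    exact fourier_triangle ξ hξ
  have hint2 : Integrable (FourierTransform.fourier f) :=
    (integrable_congr hae).2 ((integrable_sinc_pow le_rfl).comp_mul_left' pi_ne_zero).ofReal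
  have h := congrFun (hc.fourierInv_fourier_eq hint hint2) 0
  rw [Real.fourierInv_eq'] at h
  simp only [inner_zero_right, mul_zero, Complex.ofReal_zero, zero_mul, Complex.exp_zero,
    one_smul] at h
  rw [integral_congr_ae hae, integral_complex_ofReal] at h
  have h2 : f 0 = ((1 : ℝ) : ℂ) := by simp [hf]
  rw [h2, Complex.ofReal_inj, Measure.integral_comp_mul_left (fun t => sinc t ^ 2) π] at h
  rw [abs_of_pos (by positivity), smul_eq_mul] at h
  field_simp at h
  exact h

/-- Half-angle formula. It reduces integrals of trigonometric polynomials over `t²` to `∫ sinc²`. -/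
lemma one_sub_cos_div_ae (c : ℝ) : (fun t : ℝ => (1 - cos (c * t)) / t ^ 2) =ᵐ[volume]
      fun t => (c ^ 2 / 2) * sinc (c / 2 * t) ^ 2 := by
  filter_upwards [compl_mem_ae_iff.2 (measure_singleton (0 : ℝ))] with t ht
  have ht : t ≠ 0 := ht
  have h1 : c * t = 2 * (c / 2 * t) := by ring
  rw [h1, cos_two_mul, cos_sq', ← mul_sinc (c / 2 * t)]
  field_simp
  ring

lemma integrable_one_sub_cos_div {c : ℝ} (hc : 0 < c) :
    Integrable fun t => (1 - cos (c * t)) / t ^ 2 :=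
  (integrable_congr (one_sub_cos_div_ae c)).2
    (((integrable_sinc_pow le_rfl).comp_mul_left' (by positivity)).const_mul _)

lemma integral_one_sub_cos_div {c : ℝ} (hc : 0 < c) :
    ∫ t, (1 - cos (c * t)) / t ^ 2 = π * c := by
  rw [integral_congr_ae (one_sub_cos_div_ae c), integral_const_mul,
    Measure.integral_comp_mul_left (fun t => sinc t ^ 2) (c / 2), integral_sinc_sq,
    abs_of_pos (by positivity), smul_eq_mul]
  field_simp

/-! ### Integration by parts -/

lemma integral_sub_sub {f g h : ℝ → ℝ} (hf : Integrable f) (hg : Integrable g)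
    (hh : Integrable h) : ∫ t, (f t - g t - h t) = (∫ t, f t) - (∫ t, g t) - ∫ t, h t := by
  rw [← integral_sub hf hg]; exact integral_sub (hf.sub hg) hh

lemma integral_add_sub {f g h : ℝ → ℝ} (hf : Integrable f) (hg : Integrable g)
    (hh : Integrable h) : ∫ t, (f t + g t - h t) = (∫ t, f t) + (∫ t, g t) - ∫ t, h t := by
  rw [← integral_add hf hg]; exact integral_sub (hf.add hg) hh

lemma abs_sinc_pow_le_one (k : ℕ) (x : ℝ) : |sinc x ^ k| ≤ 1 := by
  rw [abs_pow]; exact pow_le_one₀ (abs_nonneg _) (abs_sinc_le_one x)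

lemma abs_mul_le_one {a b : ℝ} (ha : |a| ≤ 1) (hb : |b| ≤ 1) : |a * b| ≤ 1 := by
  rw [abs_mul]; exact mul_le_one₀ ha (abs_nonneg _) hb

lemma integrable_mul_sinc_comp_sq {g : ℝ → ℝ} (hg : Continuous g) {C : ℝ} (hC : ∀ t, |g t| ≤ C)
    {x : ℝ} (hx : x ≠ 0) : Integrable fun t => g t * sinc (x * t) ^ 2 := by
  have h := (integrable_mul_sinc_pow (g := fun t => g (x⁻¹ * t)) (by fun_prop)
    (fun t => hC _) le_rfl).comp_mul_left' hx
  simpa [← mul_assoc, inv_mul_cancel₀ hx] using h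

/-- The Euler relation for the homogeneous function `(a, b) ↦ ∫ sinc(at)² sinc(bt)^(k+1) dt`. -/
lemma euler_relation (k : ℕ) {x : ℝ} (hx : x ≠ 0) :
    2 * (∫ t, sinc (x * t) * cos (x * t) * sinc t ^ (k + 1)) +
      (k + 1) * (∫ t, sinc t ^ k * cos t * sinc (x * t) ^ 2) =
      (k + 2) * ∫ t, sinc (x * t) ^ 2 * sinc t ^ (k + 1) := by
  have hI : Integrable fun t => sinc (x * t) ^ 2 * sinc t ^ (k + 1) := by
    refine (integrable_mul_sinc_comp_sq (g := fun t => sinc t ^ (k + 1)) (by fun_prop)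
      (abs_sinc_pow_le_one _) hx).congr (ae_of_all _ fun t => mul_comm _ _)
  have hB : Integrable fun t => sinc t ^ k * cos t * sinc (x * t) ^ 2 :=
    integrable_mul_sinc_comp_sq (by fun_prop)
      (fun _ => abs_mul_le_one (abs_sinc_pow_le_one _ _) (abs_cos_le_one _)) hx
  have hA : Integrable fun t => sinc (x * t) * cos (x * t) * sinc t ^ (k + 1) := by
    have hbd := (integrable_inv_one_add_sq.const_mul 2).add
      ((integrable_inv_one_add_sq.comp_mul_left' hx).const_mul 2)
    refine hbd.mono' (Continuous.aestronglyMeasurable (by fun_prop)) (ae_of_all _ fun t => ?_)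
    have h1 := sinc_sq_le t
    have h2 := sinc_sq_le (x * t)
    -- When `k = 0` just one factor of each kind is available; their product is integrable because
    -- it is at most half the sum of the two squares.
    have h3 : |sinc (x * t) * cos (x * t) * sinc t ^ (k + 1)| ≤ |sinc (x * t)| * |sinc t| := by
      rw [pow_succ, ← mul_assoc, abs_mul, mul_right_comm, abs_mul, abs_mul _ (sinc t ^ k)]
      have := mul_le_one₀ (abs_sinc_pow_le_one k t) (abs_nonneg _) (abs_cos_le_one (x * t))
      rw [mul_assoc |sinc (x * t)|, mul_assoc |sinc (x * t)|]
      refine mul_le_mul_of_nonneg_left ?_ (abs_nonneg _)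
      exact mul_le_of_le_one_left (abs_nonneg _) this
    simp only [norm_eq_abs, Pi.add_apply]
    nlinarith [sq_nonneg (|sinc (x * t)| - |sinc t|), sq_abs (sinc t), sq_abs (sinc (x * t)), sq_nonneg (sinc t), sq_nonneg (sinc (x * t))]
  -- This is the infinitesimal form of scaling `t`: the derivative of `t` times the integrand has
  -- integral zero.
  have hd : ∀ t, HasDerivAt (fun t => t * (sinc (x * t) ^ 2 * sinc t ^ (k + 1)))
      (2 * (sinc (x * t) * cos (x * t) * sinc t ^ (k + 1)) +
        (k + 1) * (sinc t ^ k * cos t * sinc (x * t) ^ 2) -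
        (k + 2) * (sinc (x * t) ^ 2 * sinc t ^ (k + 1))) t := by
    intro t
    have h1 : HasDerivAt (fun t => sinc (x * t)) (deriv sinc (x * t) * x) t := by
      have := (hasDerivAt_sinc (x * t)).comp t ((hasDerivAt_id t).const_mul x)
      simpa [Function.comp_def] using this
    have h := (hasDerivAt_id t).mul ((h1.pow 2).mul ((hasDerivAt_sinc t).pow (k + 1)))
    convert! h using 1
    have e1 := mul_deriv_sinc (x * t)
    have e2 := mul_deriv_sinc t
    simp
    rw [show cos (x * t) = sinc (x * t) + x * t * deriv sinc (x * t) by linarith,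
      show cos t = sinc t + t * deriv sinc t by linarith]
    ring
  have hf : Integrable fun t => t * (sinc (x * t) ^ 2 * sinc t ^ (k + 1)) := by
    have := integrable_mul_sinc_comp_sq (g := fun t => sin t * sinc t ^ k) (by fun_prop)
      (fun _ => abs_mul_le_one (abs_sin_le_one _) (abs_sinc_pow_le_one _ _)) hx
    refine this.congr (ae_of_all _ fun t => ?_)
    simp only [← mul_sinc t]; ring
  have h0 := integral_eq_zero_of_hasDerivAt_of_integrable hd
    (((hA.const_mul 2).add (hB.const_mul _)).sub (hI.const_mul _)) hf
  rw [integral_add_sub (hA.const_mul 2) (hB.const_mul _) (hI.const_mul _), integral_const_mul, integral_const_mul,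
    integral_const_mul] at h0
  linarith

/-- The case `x = 1` of `euler_relation`, where the two cosine integrals coincide. -/
lemma cos_moment (k : ℕ) :
    (k + 3) * (∫ t, sinc t ^ (k + 2) * cos t) = (k + 2) * ∫ t, sinc t ^ (k + 3) := by
  have h := euler_relation k one_ne_zero
  simp only [one_mul] at h
  have e1 : ∀ t, sinc t * cos t * sinc t ^ (k + 1) = sinc t ^ (k + 2) * cos t := fun t => by ring
  have e2 : ∀ t, sinc t ^ k * cos t * sinc t ^ 2 = sinc t ^ (k + 2) * cos t := fun t => by ring
  have e3 : ∀ t, sinc t ^ 2 * sinc t ^ (k + 1) = sinc t ^ (k + 3) := fun t => by ring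
  simp only [e1, e2, e3] at h
  linarith

lemma integrable_sinc_pow_mul_cos {k : ℕ} (hk : 2 ≤ k) : Integrable fun t => sinc t ^ k * cos t :=
  (integrable_mul_sinc_pow continuous_cos abs_cos_le_one hk).congr
    (ae_of_all _ fun _ => mul_comm _ _)

lemma integrable_sinc_pow_mul_sin_sq {k : ℕ} (hk : 2 ≤ k) :
    Integrable fun t => sinc t ^ k * sin t ^ 2 :=
  (integrable_mul_sinc_pow (g := fun t => sin t ^ 2) (by fun_prop) (C := 1)
    (fun t => by rw [abs_of_nonneg (sq_nonneg _)]; exact sin_sq_le_one t) hk).congr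
    (ae_of_all _ fun _ => mul_comm _ _)

/-- The derivative of `t sinc^(k+1) cos` has integral zero. -/
lemma sin_sq_moment {k : ℕ} (hk : 2 ≤ k) :
    (k + 2) * (∫ t, sinc t ^ k * sin t ^ 2) =
      (k + 1) * (∫ t, sinc t ^ k) - k * ∫ t, sinc t ^ (k + 1) * cos t := by
  have hJ := integrable_sinc_pow hk
  have hA := integrable_sinc_pow_mul_cos (k := k + 1) (by omega)
  have hK := integrable_sinc_pow_mul_sin_sq hk
  have hd : ∀ t, HasDerivAt (fun t => t * (sinc t ^ (k + 1) * cos t))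
      ((k + 1) * sinc t ^ k - k * (sinc t ^ (k + 1) * cos t) -
        (k + 2) * (sinc t ^ k * sin t ^ 2)) t := by
    intro t
    have h := (hasDerivAt_id t).mul (((hasDerivAt_sinc t).pow (k + 1)).mul (hasDerivAt_cos t))
    convert! h using 1
    have e2 := mul_deriv_sinc t
    have e3 := mul_sinc t
    have e4 := sin_sq_add_cos_sq t
    simp
    have e5 : (t * ((↑k + 1) * sinc t ^ k * deriv sinc t * cos t + -(sinc t ^ (k + 1) * sin t))) =
      (k + 1) * sinc t ^ k * (t * deriv sinc t) * cos t - sinc t ^ k * (t * sinc t) * sin t := by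
      ring
    rw [e5, e2, e3]
    linear_combination (-(k + 1) * sinc t ^ k) * e4
  have hf : Integrable fun t => t * (sinc t ^ (k + 1) * cos t) := by
    have := integrable_mul_sinc_pow (g := fun t => sin t * cos t) (by fun_prop)
      (fun _ => abs_mul_le_one (abs_sin_le_one _) (abs_cos_le_one _)) hk
    refine this.congr (ae_of_all _ fun t => ?_)
    simp only [← mul_sinc t]; ring
  have h0 := integral_eq_zero_of_hasDerivAt_of_integrable hd
    (((hJ.const_mul _).sub (hA.const_mul _)).sub (hK.const_mul _)) hf
  rw [integral_sub_sub (hJ.const_mul _) (hA.const_mul _) (hK.const_mul _), integral_const_mul, integral_const_mul,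
    integral_const_mul] at h0
  linarith

/-! ### Closed forms for the exceptional exponent `k = 3` -/

lemma sinc_sq_mul_ae (g : ℝ → ℝ) :
    (fun t => sinc t ^ 2 * g t) =ᵐ[volume] fun t => sin t ^ 2 * g t / t ^ 2 := by
  filter_upwards [compl_mem_ae_iff.2 (measure_singleton (0 : ℝ))] with t ht
  have ht : t ≠ 0 := ht
  rw [← mul_sinc t]
  field_simp

lemma integral_sinc_sq_mul_cos : ∫ t, sinc t ^ 2 * cos t = π / 2 := by
  rw [integral_congr_ae (sinc_sq_mul_ae cos)]
  have h : ∀ t : ℝ, sin t ^ 2 * cos t / t ^ 2 =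
      1 / 4 * ((1 - cos (3 * t)) / t ^ 2) - 1 / 4 * ((1 - cos (1 * t)) / t ^ 2) := by
    intro t
    rw [cos_three_mul, one_mul, sin_sq]; ring
  simp only [h]
  rw [integral_sub ((integrable_one_sub_cos_div (by norm_num)).const_mul _)
    ((integrable_one_sub_cos_div (by norm_num)).const_mul _), integral_const_mul,
    integral_const_mul, integral_one_sub_cos_div (by norm_num),
    integral_one_sub_cos_div (by norm_num)]
  ring

lemma integral_sinc_sq_mul_sin_sq_mul_cos : ∫ t, sinc t ^ 2 * (sin t ^ 2 * cos t) = π / 8 := by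
  rw [integral_congr_ae (sinc_sq_mul_ae fun t => sin t ^ 2 * cos t)]
  have h : ∀ t : ℝ, sin t ^ 2 * (sin t ^ 2 * cos t) / t ^ 2 =
      3 / 16 * ((1 - cos (3 * t)) / t ^ 2) - 1 / 16 * ((1 - cos (5 * t)) / t ^ 2) -
        1 / 8 * ((1 - cos (1 * t)) / t ^ 2) := by
    intro t
    have h5 : cos (5 * t) = 16 * cos t ^ 5 - 20 * cos t ^ 3 + 5 * cos t := by
      rw [show 5 * t = 3 * t + 2 * t by ring, cos_add, cos_three_mul, sin_three_mul, cos_two_mul,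
        sin_two_mul]
      linear_combination (2 * cos t * (3 - 4 * (sin t ^ 2 + 1 - cos t ^ 2))) *
        (-1) * (sin_sq_add_cos_sq t)
    rw [h5, cos_three_mul, one_mul, sin_sq]; ring
  simp only [h]
  rw [integral_sub_sub ((integrable_one_sub_cos_div (by norm_num)).const_mul _)
    ((integrable_one_sub_cos_div (by norm_num)).const_mul _)
    ((integrable_one_sub_cos_div (by norm_num)).const_mul _), integral_const_mul,
    integral_const_mul, integral_const_mul, integral_one_sub_cos_div (by norm_num),
    integral_one_sub_cos_div (by norm_num), integral_one_sub_cos_div (by norm_num)]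
  ring

/-- Integrating the derivative of `sin³ sinc²` lowers the power of `t` in the denominator from three
to two. -/
lemma integral_sinc_pow_three_mul_sin_sq : ∫ t, sinc t ^ 3 * sin t ^ 2 = 5 * π / 16 := by
  have hb : ∀ t, |sin t ^ 2 * cos t| ≤ 1 := fun t => abs_mul_le_one
    (by rw [abs_of_nonneg (sq_nonneg _)]; exact sin_sq_le_one t) (abs_cos_le_one _)
  have hA : Integrable fun t => sinc t ^ 2 * (sin t ^ 2 * cos t) :=
    (integrable_mul_sinc_pow (g := fun t => sin t ^ 2 * cos t) (by fun_prop) hb le_rfl).congr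
      (ae_of_all _ fun t => mul_comm _ _)
  have hK := integrable_sinc_pow_mul_sin_sq (k := 3) (by norm_num)
  have hd : ∀ t, HasDerivAt (fun t => sin t ^ 3 * sinc t ^ 2)
      (5 * (sinc t ^ 2 * (sin t ^ 2 * cos t)) - 2 * (sinc t ^ 3 * sin t ^ 2)) t := by
    intro t
    have h := ((hasDerivAt_sin t).pow 3).mul ((hasDerivAt_sinc t).pow 2)
    convert! h using 1
    have e2 := mul_deriv_sinc t
    have e3 := mul_sinc t
    simp
    linear_combination (-2 * sinc t ^ 2 * sin t ^ 2) * e2 +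
      2 * sin t ^ 2 * sinc t * deriv sinc t * e3
  have hf : Integrable fun t => sin t ^ 3 * sinc t ^ 2 :=
    integrable_mul_sinc_pow (g := fun t => sin t ^ 3) (by fun_prop) (C := 1)
      (fun t => by rw [abs_pow]; exact pow_le_one₀ (abs_nonneg _) (abs_sin_le_one t)) le_rfl
  have h0 := integral_eq_zero_of_hasDerivAt_of_integrable hd
    ((hA.const_mul _).sub (hK.const_mul _)) hf
  rw [integral_sub (hA.const_mul _) (hK.const_mul _), integral_const_mul, integral_const_mul,
    integral_sinc_sq_mul_sin_sq_mul_cos] at h0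
  linarith

/-- The relations determine `J_3 = 3π/4` and `J_5 = 115π/192`. -/
lemma moment_gap_three : 6 * (∫ t, sinc t ^ 5) < 5 * ∫ t, sinc t ^ 3 := by
  have h1 := cos_moment 0
  have h2 := cos_moment 2
  have h3 := sin_sq_moment (k := 3) (by norm_num)
  rw [integral_sinc_pow_three_mul_sin_sq] at h3
  norm_num at h1 h2 h3
  rw [integral_sinc_sq_mul_cos] at h1
  linarith [pi_pos]

/-- `cos_moment` trades part of `J_{k+2}` for a cosine integral, so that the gap becomes one
integral against a weight independent of `k`. -/
lemma moment_gap_eq {k : ℕ} (hk : 2 ≤ k) :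
    (k + 2) * (∫ t, sinc t ^ k) - (k + 3) * (∫ t, sinc t ^ (k + 2)) =
      (k + 2) * ∫ t, sinc t ^ k * (1 - 2 * sinc t ^ 2 + sinc t * cos t) := by
  obtain ⟨j, rfl⟩ : ∃ j, k = j + 1 := ⟨k - 1, by omega⟩
  have h1 := cos_moment j
  have hJ := integrable_sinc_pow hk
  have hJ2 := integrable_sinc_pow (m := j + 3) (by omega)
  have hA := integrable_sinc_pow_mul_cos (k := j + 2) (by omega)
  have e : ∀ t, sinc t ^ (j + 1) * (1 - 2 * sinc t ^ 2 + sinc t * cos t) =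
      sinc t ^ (j + 1) + sinc t ^ (j + 2) * cos t - 2 * sinc t ^ (j + 3) := fun t => by ring
  simp only [e]
  rw [integral_add_sub hJ hA (hJ2.const_mul _), integral_const_mul]
  push_cast
  linarith

/-! ### Monotonicity of the moments of `sinc` -/

lemma nonneg_of_hasDerivAt_nonneg {f f' : ℝ → ℝ} (h0 : f 0 = 0)
    (hd : ∀ x, HasDerivAt f (f' x) x) (hn : ∀ x, 0 ≤ x → 0 ≤ f' x) {x : ℝ} (hx : 0 ≤ x) :
    0 ≤ f x := by
  have hm : MonotoneOn f (Ici 0) := by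
    refine monotoneOn_of_deriv_nonneg (convex_Ici 0)
      (fun y _ => (hd y).continuousAt.continuousWithinAt)
      (fun y _ => (hd y).differentiableAt.differentiableWithinAt) fun y hy => ?_
    rw [(hd y).deriv]
    rw [interior_Ici] at hy
    exact hn y (le_of_lt hy)
  rw [← h0]
  exact hm self_mem_Ici hx hx

/-! ### Taylor bounds for sine and cosine -/

lemma cos_le_poly_four {x : ℝ} (hx : 0 ≤ x) : cos x ≤ 1 - x ^ 2 / 2 + x ^ 4 / 24 := by
  have := nonneg_of_hasDerivAt_nonneg (f := fun x => 1 - x ^ 2 / 2 + x ^ 4 / 24 - cos x)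
    (f' := fun x => sin x - (x - x ^ 3 / 6)) (by simp)
    (fun x => by
      have := ((((hasDerivAt_id x).pow 2).div_const 2).const_sub 1).add
        (((hasDerivAt_id x).pow 4).div_const 24) |>.sub (hasDerivAt_cos x)
      convert! this using 1
      simp; ring) (fun x hx => by linarith [sin_ge_sub_cube hx]) hx
  linarith

lemma sin_le_poly_five {x : ℝ} (hx : 0 ≤ x) : sin x ≤ x - x ^ 3 / 6 + x ^ 5 / 120 := by
  have := nonneg_of_hasDerivAt_nonneg (f := fun x => x - x ^ 3 / 6 + x ^ 5 / 120 - sin x)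
    (f' := fun x => (1 - x ^ 2 / 2 + x ^ 4 / 24) - cos x) (by simp)
    (fun x => by
      have := ((hasDerivAt_id x).sub (((hasDerivAt_id x).pow 3).div_const 6)).add
        (((hasDerivAt_id x).pow 5).div_const 120) |>.sub (hasDerivAt_sin x)
      convert! this using 1
      simp; ring) (fun x hx => by linarith [cos_le_poly_four hx]) hx
  linarith

lemma poly_six_le_cos {x : ℝ} (hx : 0 ≤ x) :
    1 - x ^ 2 / 2 + x ^ 4 / 24 - x ^ 6 / 720 ≤ cos x := by
  have := nonneg_of_hasDerivAt_nonneg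
    (f := fun x => cos x - (1 - x ^ 2 / 2 + x ^ 4 / 24 - x ^ 6 / 720))
    (f' := fun x => (x - x ^ 3 / 6 + x ^ 5 / 120) - sin x) (by simp)
    (fun x => by
      have := (hasDerivAt_cos x).sub (((((hasDerivAt_id x).pow 2).div_const 2).const_sub 1).add
        (((hasDerivAt_id x).pow 4).div_const 24) |>.sub (((hasDerivAt_id x).pow 6).div_const 720))
      convert! this using 1
      simp; ring) (fun x hx => by linarith [sin_le_poly_five hx]) hx
  linarith

lemma poly_seven_le_sin {x : ℝ} (hx : 0 ≤ x) :
    x - x ^ 3 / 6 + x ^ 5 / 120 - x ^ 7 / 5040 ≤ sin x := by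
  have := nonneg_of_hasDerivAt_nonneg
    (f := fun x => sin x - (x - x ^ 3 / 6 + x ^ 5 / 120 - x ^ 7 / 5040))
    (f' := fun x => cos x - (1 - x ^ 2 / 2 + x ^ 4 / 24 - x ^ 6 / 720)) (by simp)
    (fun x => by
      have := (hasDerivAt_sin x).sub (((hasDerivAt_id x).sub
        (((hasDerivAt_id x).pow 3).div_const 6)).add
        (((hasDerivAt_id x).pow 5).div_const 120) |>.sub (((hasDerivAt_id x).pow 7).div_const 5040))
      convert! this using 1
      simp; ring) (fun x hx => by linarith [poly_six_le_cos hx]) hx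
  linarith

/-- The weight `1 - 2 sinc² + sinc cos` which controls the decay of the moments of `sinc`. -/
noncomputable def momentWeight (u : ℝ) : ℝ := 1 - 2 * sinc u ^ 2 + sinc u * cos u

lemma continuous_momentWeight : Continuous momentWeight := by
  unfold momentWeight; fun_prop

lemma sq_mul_momentWeight (u : ℝ) :
    4 * u ^ 2 * momentWeight u = (2 * u) ^ 2 + 2 * u * sin (2 * u) - 4 + 4 * cos (2 * u) := by
  rw [sin_two_mul, cos_two_mul, cos_sq', momentWeight, ← mul_sinc u]; ring

/-- With `y = 2u`, the Taylor terms of `4u²w` below order six cancel, leaving `y⁶/360 - y⁸/5040`. -/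
lemma poly_le_momentWeight {u : ℝ} (hu : 0 < u) :
    2 / 45 * u ^ 4 - 4 / 315 * u ^ 6 ≤ momentWeight u := by
  have h := sq_mul_momentWeight u
  have h1 := poly_seven_le_sin (x := 2 * u) (by positivity)
  have h2 := poly_six_le_cos (x := 2 * u) (by positivity)
  have h3 : 4 * u ^ 2 * (2 / 45 * u ^ 4 - 4 / 315 * u ^ 6) ≤ 4 * u ^ 2 * momentWeight u := by
    rw [h]
    have h4 := mul_le_mul_of_nonneg_left h1 (show 0 ≤ 2 * u by positivity)
    nlinarith
  exact le_of_mul_le_mul_left h3 (by positivity)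

lemma momentWeight_nonneg {u : ℝ} (hu : 0 < u) : 0 ≤ momentWeight u := by
  -- The polynomial bound is nonnegative up to `u² = 7/2`; for `y = 2u ≥ 7/2` the crude bound `y² -
  -- y - 8 > 0` suffices.
  by_cases h : u ≤ 7 / 4
  · refine le_trans ?_ (poly_le_momentWeight hu)
    have : 0 ≤ u ^ 4 * (2 / 45 - 4 / 315 * u ^ 2) := by
      refine mul_nonneg (by positivity) ?_
      nlinarith
    linarith
  · push Not at h
    have h1 := sq_mul_momentWeight u
    have h2 := neg_one_le_sin (2 * u)
    have h3 := neg_one_le_cos (2 * u)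
    have h4 : 0 ≤ 4 * u ^ 2 * momentWeight u := by
      rw [h1]
      nlinarith
    exact nonneg_of_mul_nonneg_right h4 (by positivity)

/-- The maximum of `1 + s - 2s²`, attained at `s = 1/4`, applied to `s = |sinc u|`. -/
lemma momentWeight_le (u : ℝ) : momentWeight u ≤ 9 / 8 := by
  unfold momentWeight
  have h1 : sinc u * cos u ≤ |sinc u| := by
    refine (le_abs_self _).trans ?_
    rw [abs_mul]
    exact mul_le_of_le_one_right (abs_nonneg _) (abs_cos_le_one u)
  nlinarith [sq_abs (sinc u), sq_nonneg (4 * |sinc u| - 1)]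

lemma sinc_nonneg {u : ℝ} (h0 : 0 ≤ u) (h : u ≤ π) : 0 ≤ sinc u := by
  rcases h0.eq_or_lt with rfl | h0
  · simp
  · rw [sinc_of_ne_zero h0.ne']
    exact div_nonneg (sin_nonneg_of_nonneg_of_le_pi h0.le h) h0.le

lemma five_eighths_le_sinc {u : ℝ} (h0 : 0 < u) (h : u ≤ 3 / 2) : 5 / 8 ≤ sinc u := by
  rw [sinc_of_ne_zero h0.ne', le_div_iff₀ h0]
  have := sin_ge_sub_cube h0.le
  have h2 : 0 ≤ u * (9 / 4 - u ^ 2) := mul_nonneg h0.le (by nlinarith)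
  nlinarith

lemma abs_sinc_le_inv {u : ℝ} (hu : 0 < u) : |sinc u| ≤ u⁻¹ := by
  rw [sinc_of_ne_zero hu.ne', abs_div, abs_of_pos hu, ← one_div]
  exact div_le_div_of_nonneg_right (abs_sin_le_one u) hu.le

/-- Beyond `4` use `1/u`; between `π` and `4`, `|sin u| ≤ u - π ≤ u/4` because `π > 3`. -/
lemma abs_sinc_le_quarter {u : ℝ} (hu : π ≤ u) : |sinc u| ≤ 1 / 4 := by
  have hu0 : 0 < u := pi_pos.trans_le hu
  by_cases h : 4 ≤ u
  · refine (abs_sinc_le_inv hu0).trans ?_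
    rw [one_div]
    exact inv_anti₀ (by norm_num) h
  · push Not at h
    rw [sinc_of_ne_zero hu0.ne', abs_div, abs_of_pos hu0, div_le_iff₀ hu0]
    have h1 : |sin u| = |sin (u - π)| := by rw [sin_sub_pi, abs_neg]
    rw [h1]
    refine abs_sin_le_abs.trans ?_
    rw [abs_of_nonneg (by linarith)]
    linarith [pi_gt_three]

lemma integrable_sinc_pow_mul_momentWeight {k : ℕ} (hk : 2 ≤ k) :
    Integrable fun u => sinc u ^ k * momentWeight u := by
  refine (integrable_mul_sinc_pow continuous_momentWeight (C := 4) (fun t => ?_) hk).congr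
    (ae_of_all _ fun t => mul_comm _ _)
  have h1 := abs_le.1 (abs_mul_le_one (abs_sinc_le_one t) (abs_cos_le_one t))
  have h2 := abs_le.1 (abs_sinc_pow_le_one 2 t)
  exact abs_le.2 ⟨by unfold momentWeight; linarith, by linarith [momentWeight_le t]⟩

/-- On `(0, 3/2]` one has `sinc ≥ 5/8`, and the polynomial minorant of the weight integrates to
slightly more than `9/250`. -/
lemma momentWeight_main_lobe {k : ℕ} (hk : 2 ≤ k) :
    (5 / 8 : ℝ) ^ k * (9 / 250) ≤ ∫ u in Ioc 0 (3 / 2 : ℝ), sinc u ^ k * momentWeight u := by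
  have h1 : ∫ u in Ioc 0 (3 / 2 : ℝ), (5 / 8 : ℝ) ^ k * (2 / 45 * u ^ 4 - 4 / 315 * u ^ 6) ≤
      ∫ u in Ioc 0 (3 / 2 : ℝ), sinc u ^ k * momentWeight u := by
    refine setIntegral_mono_on ?_ (integrable_sinc_pow_mul_momentWeight hk).integrableOn
      measurableSet_Ioc fun u hu => ?_
    · exact (Continuous.integrableOn_Icc (by fun_prop)).mono_set Ioc_subset_Icc_self
    · have h5 := five_eighths_le_sinc hu.1 hu.2
      have h6 : 0 ≤ 2 / 45 * u ^ 4 - 4 / 315 * u ^ 6 := by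
        have : 0 ≤ u ^ 4 * (2 / 45 - 4 / 315 * u ^ 2) := by
          refine mul_nonneg (by positivity) ?_
          nlinarith [hu.1, hu.2]
        linarith
      exact mul_le_mul (pow_le_pow_left₀ (by norm_num) h5 k) (poly_le_momentWeight hu.1) h6
        (by positivity)
  refine le_trans ?_ h1
  rw [← intervalIntegral.integral_of_le (by norm_num), intervalIntegral.integral_const_mul,
    intervalIntegral.integral_sub (Continuous.intervalIntegrable (by fun_prop) _ _)
    (Continuous.intervalIntegrable (by fun_prop) _ _), intervalIntegral.integral_const_mul,
    intervalIntegral.integral_const_mul, integral_pow, integral_pow]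
  refine mul_le_mul_of_nonneg_left ?_ (by positivity)
  norm_num

lemma integral_eq_two_mul_of_even {f : ℝ → ℝ} (hf : ∀ x, f (-x) = f x) :
    ∫ x, f x = 2 * ∫ x in Ioi 0, f x := by
  rw [← integral_comp_abs]
  congr 1; ext x
  rcases abs_choice x with h | h <;> rw [h]
  rw [hf]

lemma momentWeight_neg (u : ℝ) : momentWeight (-u) = momentWeight u := by
  simp [momentWeight]

/-- The discarded piece over `(3/2, π]` is nonnegative for every `k`. -/
lemma integral_split_lobes {k : ℕ} (hk : 2 ≤ k) :
    (∫ u in Ioc 0 (3 / 2 : ℝ), sinc u ^ k * momentWeight u) +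
      (∫ u in Ioi π, sinc u ^ k * momentWeight u) ≤
      ∫ u in Ioi 0, sinc u ^ k * momentWeight u := by
  have hi := integrable_sinc_pow_mul_momentWeight hk
  have h3 := pi_gt_three
  have e1 : Ioi (0 : ℝ) = Ioc 0 (3 / 2) ∪ Ioi (3 / 2) := (Ioc_union_Ioi_eq_Ioi (by norm_num)).symm
  have e2 : Ioi (3 / 2 : ℝ) = Ioc (3 / 2) π ∪ Ioi π := (Ioc_union_Ioi_eq_Ioi (by linarith)).symm
  rw [e1, setIntegral_union (Ioc_disjoint_Ioi le_rfl) measurableSet_Ioi hi.integrableOn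
    hi.integrableOn, e2, setIntegral_union (Ioc_disjoint_Ioi le_rfl) measurableSet_Ioi
    hi.integrableOn hi.integrableOn]
  have : 0 ≤ ∫ u in Ioc (3 / 2) π, sinc u ^ k * momentWeight u := by
    refine setIntegral_nonneg measurableSet_Ioc fun u hu => ?_
    have h0 : 0 < u := by linarith [hu.1]
    exact mul_nonneg (pow_nonneg (sinc_nonneg h0.le hu.2) _) (momentWeight_nonneg h0)
  linarith

lemma momentWeight_integral_pos_of_even {k : ℕ} (hk : 2 ≤ k) (he : Even k) :
    0 < ∫ u, sinc u ^ k * momentWeight u := by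
  rw [integral_eq_two_mul_of_even (fun x => by rw [sinc_neg, momentWeight_neg])]
  have h1 := integral_split_lobes hk
  have h2 := momentWeight_main_lobe hk
  have h3 : 0 ≤ ∫ u in Ioi π, sinc u ^ k * momentWeight u := by
    refine setIntegral_nonneg measurableSet_Ioi fun u hu => ?_
    exact mul_nonneg (he.pow_nonneg _) (momentWeight_nonneg (pi_pos.trans hu))
  have h4 : (0 : ℝ) < (5 / 8 : ℝ) ^ k * (9 / 250) := by positivity
  linarith

/-- For `k = 5` the main lobe contributes at least `(5/8)⁵ · 9/250 ≈ 0.0034`, the tail at worst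
`-(9/8)/(4 · 97) ≈ -0.0029`. Each further factor costs the lobe `5/8` but the tail `1/4`. -/
lemma momentWeight_integral_pos_of_five_le {k : ℕ} (hk : 5 ≤ k) :
    0 < ∫ u, sinc u ^ k * momentWeight u := by
  rw [integral_eq_two_mul_of_even (fun x => by rw [sinc_neg, momentWeight_neg])]
  have h1 := integral_split_lobes (k := k) (by omega)
  have h2 := momentWeight_main_lobe (k := k) (by omega)
  obtain ⟨j, rfl⟩ := Nat.exists_eq_add_of_le hk
  have hrp : ∀ u ∈ Ioi π, (u : ℝ) ^ (-5 : ℝ) = (u⁻¹) ^ 5 := fun u hu => by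
    have hu0 : 0 < u := pi_pos.trans hu
    rw [rpow_neg hu0.le, inv_pow]
    norm_cast
  have h3 : -((1 / 4) ^ j * (9 / 8)) * (∫ u in Ioi π, u ^ (-5 : ℝ)) ≤
      ∫ u in Ioi π, sinc u ^ (5 + j) * momentWeight u := by
    rw [← integral_const_mul]
    refine setIntegral_mono_on
      ((integrableOn_Ioi_rpow_of_lt (by norm_num) pi_pos).const_mul _)
      (integrable_sinc_pow_mul_momentWeight (by omega)).integrableOn
      measurableSet_Ioi fun u hu => ?_
    have hu0 : 0 < u := pi_pos.trans hu
    have hD := momentWeight_nonneg hu0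
    have hD2 := momentWeight_le u
    have h5 : |sinc u ^ (5 + j)| ≤ (u⁻¹) ^ 5 * (1 / 4) ^ j := by
      rw [abs_pow, pow_add]
      exact mul_le_mul (pow_le_pow_left₀ (abs_nonneg _) (abs_sinc_le_inv hu0) 5)
        (pow_le_pow_left₀ (abs_nonneg _) (abs_sinc_le_quarter (le_of_lt hu)) j)
        (by positivity) (by positivity)
    have h6 := neg_abs_le (sinc u ^ (5 + j))
    rw [hrp u hu]
    have h7 := mul_le_mul h5 hD2 hD (by positivity)
    have h8 := mul_le_mul_of_nonneg_right h6 hD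
    linarith
  rw [integral_Ioi_rpow_of_lt (by norm_num) pi_pos] at h3
  have h9 : π ^ ((-5 : ℝ) + 1) ≤ 1 / 97 := by
    rw [show ((-5 : ℝ) + 1) = -((4 : ℕ) : ℝ) by norm_num, rpow_neg pi_pos.le, rpow_natCast,
      ← one_div]
    refine one_div_le_one_div_of_le (by norm_num) ?_
    calc (97 : ℝ) ≤ 3.14 ^ 4 := by norm_num
      _ ≤ π ^ 4 := pow_le_pow_left₀ (by norm_num) pi_gt_d2.le 4
  have h10 : (1 / 4 : ℝ) ^ j ≤ (5 / 8) ^ j := pow_le_pow_left₀ (by norm_num) (by norm_num) j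
  have h11 : (0 : ℝ) < (1 / 4) ^ j := by positivity
  rw [pow_add] at h2
  have h12 := mul_le_mul_of_nonneg_left h9 h11.le
  norm_num at h2 h3 h12 ⊢
  nlinarith

/-- `∫ sinc^(k+2) < (k+2)/(k+3) ∫ sinc^k`. -/
lemma moment_gap {k : ℕ} (hk : 2 ≤ k) :
    (k + 3) * (∫ t, sinc t ^ (k + 2)) < (k + 2) * ∫ t, sinc t ^ k := by
  -- The lobe estimate is too weak for the only odd exponent below five.
  by_cases h3 : k = 3
  · subst h3
    have := moment_gap_three
    norm_num
    linarith
  have h := moment_gap_eq hk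
  have hpos : 0 < ∫ u, sinc u ^ k * momentWeight u := by
    rcases Nat.even_or_odd k with he | ho
    · exact momentWeight_integral_pos_of_even hk he
    · refine momentWeight_integral_pos_of_five_le ?_
      obtain ⟨j, rfl⟩ := ho
      omega
  have : (0 : ℝ) < (k + 2) * ∫ u, sinc u ^ k * momentWeight u := by positivity
  simp only [momentWeight] at this
  linarith

/-! ### Upper bound for the moments -/

/-- `sinc t · exp(t²/6)` is decreasing on `[0, π]`. The sign of its derivative is that of `t cos t -
sin t + t² sin t / 3`, whose own derivative is `(t/3)(t cos t - sin t) ≤ 0`. -/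
lemma sinc_le_gaussian {t : ℝ} (h0 : 0 ≤ t) (h : t ≤ π) : sinc t ≤ exp (-(1 / 6) * t ^ 2) := by
  have hy : ∀ t ∈ Icc 0 π, t * cos t - sin t ≤ 0 := by
    intro t ht
    have hm : AntitoneOn (fun t => t * cos t - sin t) (Icc 0 π) := by
      refine antitoneOn_of_deriv_nonpos (convex_Icc _ _) (by fun_prop) (by fun_prop) fun y hy => ?_
      rw [interior_Icc] at hy
      have h := ((hasDerivAt_id y).mul (hasDerivAt_cos y)).sub (hasDerivAt_sin y)
      have h' : deriv (fun t => t * cos t - sin t) y = -(y * sin y) := by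
        rw [show (fun t => t * cos t - sin t) = (id * cos - sin) from rfl, h.deriv]; simp
      rw [h']
      have := mul_nonneg hy.1.le (sin_nonneg_of_nonneg_of_le_pi hy.1.le hy.2.le)
      linarith
    have := hm (left_mem_Icc.2 pi_pos.le) ht ht.1
    simpa using this
  have hw : ∀ t ∈ Icc 0 π, t * cos t - sin t + t ^ 2 * sin t / 3 ≤ 0 := by
    intro t ht
    have hm : AntitoneOn (fun t => t * cos t - sin t + t ^ 2 * sin t / 3) (Icc 0 π) := by
      refine antitoneOn_of_deriv_nonpos (convex_Icc _ _) (by fun_prop) (by fun_prop) fun y hy' => ?_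
      rw [interior_Icc] at hy'
      have h := (((hasDerivAt_id y).mul (hasDerivAt_cos y)).sub (hasDerivAt_sin y)).add
        ((((hasDerivAt_id y).pow 2).mul (hasDerivAt_sin y)).div_const 3)
      have h' : deriv (fun t => t * cos t - sin t + t ^ 2 * sin t / 3) y =
          y / 3 * (y * cos y - sin y) := by
        refine HasDerivAt.deriv ?_
        convert! h using 1
        simp; ring
      rw [h']
      exact mul_nonpos_of_nonneg_of_nonpos (by linarith [hy'.1]) (hy y ⟨hy'.1.le, hy'.2.le⟩)
    have := hm (left_mem_Icc.2 pi_pos.le) ht ht.1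
    simpa using this
  have hd : ∀ t, HasDerivAt (fun t => sinc t * exp (1 / 6 * t ^ 2))
      ((deriv sinc t + t * sinc t / 3) * exp (1 / 6 * t ^ 2)) t := by
    intro t
    have h := (hasDerivAt_sinc t).mul (((((hasDerivAt_id t).pow 2).const_mul (1 / 6)).exp))
    convert! h using 1
    simp; ring
  have hm : AntitoneOn (fun t => sinc t * exp (1 / 6 * t ^ 2)) (Icc 0 π) := by
    refine antitoneOn_of_deriv_nonpos (convex_Icc _ _) (by fun_prop)
      (fun y _ => (hd y).differentiableAt.differentiableWithinAt) fun y hy => ?_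
    rw [interior_Icc] at hy
    rw [(hd y).deriv]
    refine mul_nonpos_of_nonpos_of_nonneg ?_ (exp_pos _).le
    have h1 := hw y ⟨hy.1.le, hy.2.le⟩
    rw [← mul_sinc y] at h1
    have h2 := mul_deriv_sinc y
    have h3 : y ^ 2 * (deriv sinc y + y * sinc y / 3) ≤ 0 := by
      have : y ^ 2 * (deriv sinc y + y * sinc y / 3) =
        y * (y * deriv sinc y) + y ^ 2 * (y * sinc y) / 3 := by ring
      rw [this, h2]; linarith
    by_contra hc
    push Not at hc
    have := mul_pos (pow_pos hy.1 2) hc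
    linarith
  have := hm (left_mem_Icc.2 pi_pos.le) ⟨h0, h⟩ h0
  simp only [sinc_zero, one_mul] at this
  rw [neg_mul, exp_neg, ← one_div, le_div_iff₀ (exp_pos _)]
  simpa using this

/-- The central section orthogonal to the main diagonal is smaller than `√2`. -/
lemma sqrt_mul_moment_lt {n : ℕ} (hn : 4 ≤ n) : √n * ∫ t, sinc t ^ n < √2 * π := by
  have hi := integrable_sinc_pow (m := n) (by omega)
  have hn' : (4 : ℝ) ≤ n := by exact_mod_cast hn
  have hn0 : (0 : ℝ) < n := by linarith
  rw [integral_eq_two_mul_of_even (fun x => by rw [sinc_neg])]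
  have e1 : Ioi (0 : ℝ) = Ioc 0 π ∪ Ioi π := (Ioc_union_Ioi_eq_Ioi pi_pos.le).symm
  have hb : (0 : ℝ) < n / 6 := by positivity
  have h1 : ∫ t in Ioc 0 π, sinc t ^ n ≤ √(π / (n / 6)) / 2 := by
    rw [← integral_gaussian_Ioi]
    have hg : IntegrableOn (fun t : ℝ => exp (-(n / 6 : ℝ) * t ^ 2)) (Ioi 0) :=
      (integrable_exp_neg_mul_sq hb).integrableOn
    calc ∫ t in Ioc 0 π, sinc t ^ n ≤ ∫ t in Ioc 0 π, exp (-(n / 6 : ℝ) * t ^ 2) := by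
          refine setIntegral_mono_on hi.integrableOn (hg.mono_set Ioc_subset_Ioi_self)
            measurableSet_Ioc fun t ht => ?_
          refine (pow_le_pow_left₀ (sinc_nonneg ht.1.le ht.2)
            (sinc_le_gaussian ht.1.le ht.2) n).trans_eq ?_
          rw [← exp_nat_mul]
          congr 1; ring
      _ ≤ _ := setIntegral_mono_set hg (ae_of_all _ fun t => (exp_pos _).le)
          (Ioc_subset_Ioi_self.eventuallyLE)
  have h2 : ∫ t in Ioi π, sinc t ^ n ≤ 1 / (31 * (n - 1)) := by
    have hlt : (-n : ℝ) < -1 := by linarith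
    calc ∫ t in Ioi π, sinc t ^ n ≤ ∫ t in Ioi π, t ^ (-n : ℝ) := by
          refine setIntegral_mono_on hi.integrableOn
            (integrableOn_Ioi_rpow_of_lt hlt pi_pos) measurableSet_Ioi fun t ht => ?_
          have ht0 : 0 < t := pi_pos.trans ht
          rw [rpow_neg ht0.le, rpow_natCast, ← inv_pow]
          refine (le_abs_self _).trans ?_
          rw [abs_pow]
          exact pow_le_pow_left₀ (abs_nonneg _) (abs_sinc_le_inv ht0) n
      _ = π ^ (-(n : ℝ) + 1) / (n - 1) := by
          rw [integral_Ioi_rpow_of_lt hlt pi_pos, ← neg_div_neg_eq]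
          congr 1 <;> ring
      _ ≤ (1 / 31) / (n - 1) := by
          refine div_le_div_of_nonneg_right ?_ (by linarith)
          calc π ^ (-(n : ℝ) + 1) ≤ π ^ (-((3 : ℕ) : ℝ)) :=
                rpow_le_rpow_of_exponent_le (by linarith [pi_gt_three]) (by push_cast; linarith)
            _ ≤ 1 / 31 := by
                rw [rpow_neg pi_pos.le, rpow_natCast, ← one_div]
                refine one_div_le_one_div_of_le (by norm_num) ?_
                nlinarith [pi_gt_d4, pow_le_pow_left₀ (show (0:ℝ) ≤ 3.1415 by norm_num) pi_gt_d4.le 3]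
      _ = _ := by rw [div_div]
  rw [e1, setIntegral_union (Ioc_disjoint_Ioi le_rfl) measurableSet_Ioi hi.integrableOn
    hi.integrableOn]
  have h3 : √n * √(π / (n / 6)) = √(6 * π) := by
    rw [← sqrt_mul (by positivity)]; congr 1; field_simp
  -- Here `31 < π³`, and `√n/(n-1) ≤ 2/3` with equality at `n = 4`.
  have h4 : √n * (1 / (31 * (n - 1))) ≤ 2 / 93 := by
    have : √(n : ℝ) ≤ 2 / 3 * (n - 1) := by
      rw [sqrt_le_left (by linarith)]
      nlinarith
    rw [mul_one_div, div_le_iff₀ (by linarith)]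
    linarith
  have h5 : √(6 * π) < 4.342 := by
    rw [sqrt_lt' (by norm_num)]
    nlinarith [pi_lt_d4]
  have h6 : 4.44 < √2 * π := by
    have : (1.414 : ℝ) < √2 := by
      rw [lt_sqrt (by norm_num)]; norm_num
    nlinarith [pi_gt_d4]
  have h7 := mul_le_mul_of_nonneg_left (add_le_add h1 h2) (sqrt_nonneg (n : ℝ))
  have h8 : √n * (√(π / (n / 6)) / 2 + 1 / (31 * (n - 1))) ≤ 4.342 / 2 + 2 / 93 := by
    rw [mul_add, ← mul_div_assoc, h3]
    linarith
  have h9 : √n * (2 * ((∫ t in Ioc 0 π, sinc t ^ n) + ∫ t in Ioi π, sinc t ^ n)) ≤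
      2 * (4.342 / 2 + 2 / 93) := by
    linarith
  refine h9.trans_lt (lt_trans ?_ h6)
  norm_num

/-! ### The one-parameter family of sections -/

lemma ae_ne_zero : ∀ᵐ t : ℝ, t ≠ 0 :=
  compl_mem_ae_iff.2 (measure_singleton (0 : ℝ))

/-- `∫ (sin(xt)/t)² sinc(t)^m dt`. -/
noncomputable def sinSqIntegral (m : ℕ) (x : ℝ) : ℝ := ∫ t, (sin (x * t) / t) ^ 2 * sinc t ^ m

/-- `∫ sin(2xt)/(2t) sinc(t)^m dt`. -/
noncomputable def sinIntegral (m : ℕ) (x : ℝ) : ℝ := ∫ t, sin (2 * x * t) / (2 * t) * sinc t ^ m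

/-- `∫ cos(2xt) sinc(t)^m dt`. -/
noncomputable def cosIntegral (m : ℕ) (x : ℝ) : ℝ := ∫ t, cos (2 * x * t) * sinc t ^ m

lemma abs_sin_mul_div_le (x t : ℝ) : |sin (x * t) / t| ≤ |x| := by
  rcases eq_or_ne t 0 with rfl | ht
  · simp
  · rw [abs_div, div_le_iff₀ (abs_pos.2 ht), ← abs_mul]
    exact abs_sin_le_abs

lemma measurable_sinc_pow (m : ℕ) : Measurable fun t => sinc t ^ m :=
  (continuous_sinc.pow m).measurable

lemma integrable_abs_sinc_pow {m : ℕ} (hm : 2 ≤ m) : Integrable fun t => |sinc t| ^ m :=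
  (integrable_sinc_pow hm).abs.congr (ae_of_all _ fun _ => abs_pow _ _)

/-- With `sin(xt)/t` in place of `sinc(xt)`, the parameter `x` occurs only inside a sine, so two
differentiations under the integral remain dominated by multiples of `|sinc|^m`. -/
lemma hasDerivAt_sinSqIntegral {m : ℕ} (hm : 2 ≤ m) (x : ℝ) :
    HasDerivAt (sinSqIntegral m) (2 * sinIntegral m x) x := by
  have hmeas : ∀ y : ℝ, AEStronglyMeasurable
      (fun t => (sin (y * t) / t) ^ 2 * sinc t ^ m) volume := fun y =>
    Measurable.aestronglyMeasurable (by have := measurable_sinc_pow m; fun_prop)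
  have h := hasDerivAt_integral_of_dominated_loc_of_deriv_le (μ := volume)
    (F := fun y t => (sin (y * t) / t) ^ 2 * sinc t ^ m)
    (F' := fun y t => 2 * (sin (2 * y * t) / (2 * t) * sinc t ^ m))
    (bound := fun t => 2 * ((|x| + 1) * |sinc t| ^ m)) (x₀ := x)
    (Metric.ball_mem_nhds x one_pos) (Eventually.of_forall hmeas) ?_ ?_ ?_ ?_ ?_
  · have h2 := h.2
    rwa [integral_const_mul] at h2
  · refine ((integrable_abs_sinc_pow hm).const_mul (|x| ^ 2)).mono' (hmeas x)
      (ae_of_all _ fun t => ?_)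
    rw [norm_mul, norm_pow, norm_pow, norm_eq_abs, norm_eq_abs]
    exact mul_le_mul_of_nonneg_right
      (pow_le_pow_left₀ (abs_nonneg _) (abs_sin_mul_div_le x t) 2) (by positivity)
  · exact Measurable.aestronglyMeasurable (by have := measurable_sinc_pow m; fun_prop)
  · refine ae_of_all _ fun t y hy => ?_
    rw [norm_mul, norm_mul, norm_pow, norm_eq_abs, norm_eq_abs, norm_eq_abs, abs_two]
    refine mul_le_mul_of_nonneg_left (mul_le_mul_of_nonneg_right ?_ (by positivity)) (by norm_num)
    have h1 := abs_sin_mul_div_le y (2 * t)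
    rw [show y * (2 * t) = 2 * y * t by ring] at h1
    refine h1.trans ?_
    rw [Metric.mem_ball, dist_eq] at hy
    have := abs_sub_abs_le_abs_sub y x
    linarith
  · exact ((integrable_abs_sinc_pow hm).const_mul _).const_mul _
  · filter_upwards [ae_ne_zero] with t ht y _
    have h1 : HasDerivAt (fun y => sin (y * t)) (cos (y * t) * t) y := by
      simpa using ((hasDerivAt_id y).mul_const t).sin
    have h2 := ((h1.div_const t).pow 2).mul_const (sinc t ^ m)
    convert! h2 using 1
    rw [show 2 * y * t = 2 * (y * t) by ring, sin_two_mul]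
    norm_num
    field_simp

lemma hasDerivAt_sinIntegral {m : ℕ} (hm : 2 ≤ m) (x : ℝ) :
    HasDerivAt (sinIntegral m) (cosIntegral m x) x := by
  have hmeas : ∀ y : ℝ, AEStronglyMeasurable
      (fun t => sin (2 * y * t) / (2 * t) * sinc t ^ m) volume := fun y =>
    Measurable.aestronglyMeasurable (by have := measurable_sinc_pow m; fun_prop)
  refine (hasDerivAt_integral_of_dominated_loc_of_deriv_le (μ := volume)
    (F := fun y t => sin (2 * y * t) / (2 * t) * sinc t ^ m)
    (F' := fun y t => cos (2 * y * t) * sinc t ^ m)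
    (bound := fun t => |sinc t| ^ m) (x₀ := x)
    univ_mem (Eventually.of_forall hmeas) ?_ ?_ ?_ ?_ ?_).2
  · refine ((integrable_abs_sinc_pow hm).const_mul |x|).mono' (hmeas x)
      (ae_of_all _ fun t => ?_)
    rw [norm_mul, norm_pow, norm_eq_abs, norm_eq_abs]
    refine mul_le_mul_of_nonneg_right ?_ (by positivity)
    have h1 := abs_sin_mul_div_le x (2 * t)
    rwa [show x * (2 * t) = 2 * x * t by ring] at h1
  · exact Measurable.aestronglyMeasurable (by have := measurable_sinc_pow m; fun_prop)
  · refine ae_of_all _ fun t y _ => ?_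
    rw [norm_mul, norm_pow, norm_eq_abs, norm_eq_abs]
    exact mul_le_of_le_one_left (by positivity) (abs_cos_le_one _)
  · exact integrable_abs_sinc_pow hm
  · filter_upwards [ae_ne_zero] with t ht y _
    have h1 : HasDerivAt (fun y => sin (2 * y * t)) (cos (2 * y * t) * (2 * t)) y := by
      simpa using (((hasDerivAt_id y).const_mul 2).mul_const t).sin
    have h2 := (h1.div_const (2 * t)).mul_const (sinc t ^ m)
    convert! h2 using 1
    field_simp

lemma sinSqIntegral_eq (m : ℕ) {x : ℝ} (hx : x ≠ 0) :
    sinSqIntegral m x = x ^ 2 * ∫ t, sinc (x * t) ^ 2 * sinc t ^ m := by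
  rw [← integral_const_mul]
  refine integral_congr_ae ?_
  filter_upwards [ae_ne_zero] with t ht
  rw [← mul_sinc (x * t)]
  field_simp

lemma sinIntegral_eq (m : ℕ) {x : ℝ} (hx : x ≠ 0) :
    sinIntegral m x = x * ∫ t, sinc (x * t) * cos (x * t) * sinc t ^ m := by
  rw [← integral_const_mul]
  refine integral_congr_ae ?_
  filter_upwards [ae_ne_zero] with t ht
  rw [show 2 * x * t = 2 * (x * t) by ring, sin_two_mul, ← mul_sinc (x * t)]
  field_simp

/-- The numerator of the derivative of the section volume along the family. -/
noncomputable def slopeNumerator (m : ℕ) (x : ℝ) : ℝ :=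
  (2 * x ^ 2 + m) * (x * sinIntegral m x) - (x ^ 2 + m) * sinSqIntegral m x

/-- `π` times the section volume in the direction `(x, x, 1, …, 1)`. -/
noncomputable def familyVolume (m : ℕ) (x : ℝ) : ℝ :=
  √(2 * x ^ 2 + m) * (sinSqIntegral m x / x ^ 2)

lemma hasDerivAt_familyVolume {m : ℕ} (hm : 2 ≤ m) {x : ℝ} (hx : 0 < x) :
    HasDerivAt (familyVolume m) (2 * slopeNumerator m x / (x ^ 3 * √(2 * x ^ 2 + m))) x := by
  have hpos : 0 < 2 * x ^ 2 + (m : ℝ) := by positivity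
  have h1 : HasDerivAt (fun x : ℝ => 2 * x ^ 2 + (m : ℝ)) (4 * x) x := by
    have := (((hasDerivAt_id x).pow 2).const_mul 2).add_const (m : ℝ)
    convert! this using 1
    simp; ring
  have h2 := (h1.sqrt hpos.ne').mul
    ((hasDerivAt_sinSqIntegral hm x).div ((hasDerivAt_id x).pow 2) (by simpa using hx.ne'))
  convert! h2 using 1
  have hs := sqrt_pos.2 hpos
  have hs2 := sq_sqrt hpos.le
  simp only [slopeNumerator, id, Pi.pow_apply, Pi.div_apply]
  field_simp
  rw [hs2]
  push_cast
  ring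

lemma continuous_slopeNumerator {m : ℕ} (hm : 2 ≤ m) : Continuous (slopeNumerator m) := by
  have h1 : Continuous (sinSqIntegral m) :=
    continuous_iff_continuousAt.2 fun x => (hasDerivAt_sinSqIntegral hm x).continuousAt
  have h2 : Continuous (sinIntegral m) :=
    continuous_iff_continuousAt.2 fun x => (hasDerivAt_sinIntegral hm x).continuousAt
  unfold slopeNumerator
  fun_prop

lemma sinSqIntegral_one (m : ℕ) : sinSqIntegral m 1 = ∫ t, sinc t ^ (m + 2) := by
  rw [sinSqIntegral_eq m one_ne_zero]
  simp only [one_pow, one_mul]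
  congr 1; ext t; ring

lemma sinIntegral_one {m : ℕ} (hm : 2 ≤ m) :
    (m + 2) * sinIntegral m 1 = (m + 1) * ∫ t, sinc t ^ (m + 2) := by
  obtain ⟨k, rfl⟩ : ∃ k, m = k + 1 := ⟨m - 1, by omega⟩
  have h := cos_moment k
  rw [sinIntegral_eq _ one_ne_zero]
  have e : ∀ t, sinc (1 * t) * cos (1 * t) * sinc t ^ (k + 1) = sinc t ^ (k + 2) * cos t := by
    intro t; rw [one_mul]; ring
  simp only [e]
  push_cast
  linarith

lemma cosIntegral_one {m : ℕ} (hm : 2 ≤ m) :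
    (m + 2) * cosIntegral m 1 = 2 * m * sinIntegral m 1 - m * ∫ t, sinc t ^ m := by
  have h := sin_sq_moment hm
  have e : ∀ t, cos (2 * 1 * t) * sinc t ^ m = sinc t ^ m - 2 * (sinc t ^ m * sin t ^ 2) := by
    intro t; rw [mul_one, cos_two_mul, cos_sq']; ring
  have e2 : ∀ t, sinc (1 * t) * cos (1 * t) * sinc t ^ m = sinc t ^ (m + 1) * cos t := by
    intro t; rw [one_mul]; ring
  rw [sinIntegral_eq _ one_ne_zero, cosIntegral]
  simp only [e, e2]
  rw [integral_sub (integrable_sinc_pow hm)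
    ((integrable_sinc_pow_mul_sin_sq hm).const_mul _), integral_const_mul]
  linarith

lemma slopeNumerator_one {m : ℕ} (hm : 2 ≤ m) : slopeNumerator m 1 = 0 := by
  have h := sinIntegral_one hm
  rw [slopeNumerator, sinSqIntegral_one]
  linarith

/-- By the moment relations, `(m+2)` times the derivative equals `m ((m+3) J_{m+2} - (m+2) J_m)`, so
`moment_gap` decides its sign. -/
lemma hasDerivAt_slopeNumerator_one {m : ℕ} (hm : 2 ≤ m) :
    ∃ d < 0, HasDerivAt (slopeNumerator m) d 1 := by
  have h0 := (((hasDerivAt_id (1 : ℝ)).pow 2).const_mul 2).add_const (m : ℝ)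
  have h1 := ((hasDerivAt_id (1 : ℝ)).pow 2).add_const (m : ℝ)
  have h2 := (hasDerivAt_id (1 : ℝ)).mul (hasDerivAt_sinIntegral hm 1)
  have h := (h0.mul h2).sub (h1.mul (hasDerivAt_sinSqIntegral hm 1))
  refine ⟨_, ?_, h⟩
  have e1 := sinIntegral_one hm
  have e2 := cosIntegral_one hm
  have e3 := sinSqIntegral_one m
  have e4 := moment_gap hm
  have hm0 : (0 : ℝ) < m := by positivity
  simp
  rw [e3]
  have e5 := mul_lt_mul_of_pos_left e4 hm0
  have key : ((m : ℝ) + 2) * (2 * 2 * sinIntegral m 1 +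
      (2 + m) * (sinIntegral m 1 + cosIntegral m 1) -
      (2 * (∫ t, sinc t ^ (m + 2)) + (1 + m) * (2 * sinIntegral m 1))) < 0 := by
    have : ((m : ℝ) + 2) * (2 * 2 * sinIntegral m 1 +
      (2 + m) * (sinIntegral m 1 + cosIntegral m 1) -
      (2 * (∫ t, sinc t ^ (m + 2)) + (1 + m) * (2 * sinIntegral m 1))) =
      (m : ℝ) * ((m + 3) * (∫ t, sinc t ^ (m + 2))) - m * ((m + 2) * ∫ t, sinc t ^ m) := by
      linear_combination ((m : ℝ) + 4) * e1 + ((m : ℝ) + 2) * e2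
    linarith
  have := neg_of_mul_neg_right key (by positivity)
  linarith

/-- After `u = xt` the factors `sinc(u/x)^m` tend to `1`, with `sinc² u` as majorant. -/
lemma tendsto_familyVolume {m : ℕ} :
    Tendsto (familyVolume m) atTop (𝓝 (√2 * π)) := by
  have h1 : Tendsto (fun x : ℝ => ∫ u, sinc u ^ 2 * sinc (x⁻¹ * u) ^ m) atTop
      (𝓝 (∫ u, sinc u ^ 2)) := by
    refine tendsto_integral_filter_of_dominated_convergence (fun u => sinc u ^ 2)
      (Eventually.of_forall fun x => Continuous.aestronglyMeasurable (by fun_prop))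
      (Eventually.of_forall fun x => ae_of_all _ fun u => ?_) (integrable_sinc_pow le_rfl)
      (ae_of_all _ fun u => ?_)
    · rw [norm_mul, norm_eq_abs, norm_eq_abs, abs_of_nonneg (sq_nonneg _)]
      exact mul_le_of_le_one_right (sq_nonneg _) (abs_sinc_pow_le_one _ _)
    · have h := (((continuous_sinc.tendsto 0).comp
        (by simpa using tendsto_inv_atTop_zero.mul_const u)).pow m).const_mul (sinc u ^ 2)
      simpa [Function.comp_def] using h
  have h2 : Tendsto (fun x : ℝ => √(2 + m * (x⁻¹) ^ 2)) atTop (𝓝 √2) := by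
    have h := (((tendsto_inv_atTop_zero (𝕜 := ℝ)).pow 2).const_mul (m : ℝ)).const_add 2
    simpa using h.sqrt
  have h3 := h2.mul h1
  rw [integral_sinc_sq] at h3
  refine h3.congr' ?_
  filter_upwards [eventually_gt_atTop 0] with x hx
  have e1 : √(2 * x ^ 2 + m) = x * √(2 + m * (x⁻¹) ^ 2) := by
    rw [show 2 * x ^ 2 + (m : ℝ) = x ^ 2 * (2 + m * (x⁻¹) ^ 2) by field_simp,
      sqrt_mul (sq_nonneg x), sqrt_sq hx.le]
  have e2 := Measure.integral_comp_mul_left (fun u => sinc u ^ 2 * sinc (x⁻¹ * u) ^ m) x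
  simp only [inv_mul_cancel_left₀ hx.ne', abs_of_pos (inv_pos.2 hx), smul_eq_mul] at e2
  rw [familyVolume, sinSqIntegral_eq m hx.ne', mul_div_cancel_left₀ _ (by positivity), e2, e1]
  field_simp

lemma familyVolume_one_lt {m : ℕ} (hm : 2 ≤ m) : familyVolume m 1 < √2 * π := by
  have h := sqrt_mul_moment_lt (n := m + 2) (by omega)
  rw [familyVolume, sinSqIntegral_one]
  push_cast at h
  simpa [add_comm] using h

/-- The section volume has a critical point along the family besides the main diagonal. -/
lemma exists_slopeNumerator_eq_zero {m : ℕ} (hm : 2 ≤ m) : ∃ x, 1 < x ∧ slopeNumerator m x = 0 := by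
  by_contra! hne
  obtain ⟨d, hd, hder⟩ := hasDerivAt_slopeNumerator_one hm
  obtain ⟨y, hy1, hy⟩ : ∃ y, 1 < y ∧ slopeNumerator m y < 0 := by
    have hs := (hasDerivWithinAt_iff_tendsto_slope' (s := Ioi (1 : ℝ)) (by simp)).1
      hder.hasDerivWithinAt
    have hev := (hs.eventually (gt_mem_nhds hd)).and self_mem_nhdsWithin
    obtain ⟨y, hy, hy1⟩ := hev.exists
    refine ⟨y, hy1, ?_⟩
    rw [slope_def_field, slopeNumerator_one hm, sub_zero] at hy
    have hpos : 0 < y - 1 := sub_pos.2 hy1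
    by_contra hc
    exact absurd hy (not_lt.2 (div_nonneg (not_lt.1 hc) hpos.le))
  -- Negativity just to the right of `1` propagates, since a sign change would produce a zero.
  have hneg : ∀ x, 1 < x → slopeNumerator m x < 0 := by
    intro x hx
    by_contra hc
    obtain ⟨z, hz, hz0⟩ := isPreconnected_Ioi.intermediate_value (show y ∈ Ioi (1 : ℝ) from hy1)
      (show x ∈ Ioi (1 : ℝ) from hx) (continuous_slopeNumerator hm).continuousOn
      ⟨hy.le, not_lt.1 hc⟩
    exact hne z hz hz0
  have hanti : AntitoneOn (familyVolume m) (Ici 1) := by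
    refine antitoneOn_of_deriv_nonpos (convex_Ici 1)
      (fun x hx => (hasDerivAt_familyVolume hm
        (zero_lt_one.trans_le hx)).continuousAt.continuousWithinAt)
      (fun x hx => ?_) fun x hx => ?_
    · exact (hasDerivAt_familyVolume hm
        (zero_lt_one.trans_le (interior_subset hx))).differentiableAt.differentiableWithinAt
    · rw [interior_Ici] at hx
      have hx0 : 0 < x := zero_lt_one.trans hx
      rw [(hasDerivAt_familyVolume hm hx0).deriv]
      have := hneg x hx
      exact div_nonpos_of_nonpos_of_nonneg (by linarith) (by positivity)
  have hle : √2 * π ≤ familyVolume m 1 := by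
    refine le_of_tendsto (tendsto_familyVolume (m := m)) ?_
    filter_upwards [eventually_ge_atTop 1] with x hx
    exact hanti self_mem_Ici hx hx
  exact absurd (familyVolume_one_lt hm) (not_lt.2 hle)

lemma exists_critical_ratio {m : ℕ} (hm : 2 ≤ m) : ∃ x : ℝ, 1 < x ∧
    (2 * x ^ 2 + m) * (∫ t, sinc (x * t) * cos (x * t) * sinc t ^ m) =
      (x ^ 2 + m) * ∫ t, sinc (x * t) ^ 2 * sinc t ^ m := by
  obtain ⟨x, hx, h⟩ := exists_slopeNumerator_eq_zero hm
  have hx0 : 0 < x := zero_lt_one.trans hx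
  refine ⟨x, hx, ?_⟩
  rw [slopeNumerator, sinSqIntegral_eq m hx0.ne', sinIntegral_eq m hx0.ne'] at h
  have : x ^ 2 ≠ 0 := by positivity
  refine mul_left_cancel₀ this ?_
  linarith

/-! ### Differentiability of the Fourier integral of the section volume -/

/-- The integral `∫ ∏ᵢ sinc(vᵢ t) dt`. -/
noncomputable def sincProdIntegral {n : ℕ} (v : EuclideanSpace ℝ (Fin n)) : ℝ :=
  ∫ t, ∏ i, sinc (v i * t)

/-- Two factors already give quadratic decay. Bounding every `sinc²` by one `r ≤ 1` makes the
squared product at most `r²`, without singling out two indices. -/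
lemma abs_prod_sinc_le {ι : Type*} {S : Finset ι} (hS : 2 ≤ S.card) {c : ℝ} (hc : 0 < c)
    {x : ι → ℝ} (hx : ∀ j ∈ S, c ≤ |x j|) (t : ℝ) :
    |∏ j ∈ S, sinc (x j * t)| ≤ 2 * (1 + (c * t) ^ 2)⁻¹ := by
  set r : ℝ := min 1 (2 * (1 + (c * t) ^ 2)⁻¹) with hr
  have hr0 : 0 ≤ r := le_min zero_le_one (by positivity)
  have h1 : ∀ j ∈ S, sinc (x j * t) ^ 2 ≤ r := by
    intro j hj
    refine le_min ?_ ?_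
    · exact (le_abs_self _).trans (abs_sinc_pow_le_one 2 _)
    · refine (sinc_sq_le _).trans ?_
      refine mul_le_mul_of_nonneg_left (inv_anti₀ (by positivity) ?_) (by norm_num)
      rw [mul_pow, mul_pow, ← sq_abs (x j)]
      have := pow_le_pow_left₀ hc.le (hx j hj) 2
      nlinarith [sq_nonneg t]
  have h2 : (∏ j ∈ S, sinc (x j * t)) ^ 2 ≤ r ^ 2 := by
    rw [← Finset.prod_pow]
    calc ∏ j ∈ S, sinc (x j * t) ^ 2 ≤ ∏ _j ∈ S, r :=
          Finset.prod_le_prod (fun j _ => sq_nonneg _) h1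
      _ = r ^ S.card := Finset.prod_const _
      _ ≤ r ^ 2 := pow_le_pow_of_le_one hr0 (min_le_left _ _) hS
  exact (abs_le_of_sq_le_sq h2 hr0).trans (min_le_right _ _)

lemma integrable_sinc_majorant {c : ℝ} (hc : 0 < c) :
    Integrable fun t : ℝ => 2 * (1 + (c * t) ^ 2)⁻¹ :=
  (integrable_inv_one_add_sq.comp_mul_left' hc.ne').const_mul 2

lemma exists_pos_lt_abs {n : ℕ} {v : EuclideanSpace ℝ (Fin n)} (hv : ∀ i, v i ≠ 0) :
    ∃ c > 0, ∀ i, c < |v i| := by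
  by_cases hn : n = 0
  · subst hn; exact ⟨1, one_pos, fun i => i.elim0⟩
  have : Nonempty (Fin n) := ⟨⟨0, Nat.pos_of_ne_zero hn⟩⟩
  obtain ⟨i, hi⟩ := Finite.exists_min fun i => |v i|
  have hp := abs_pos.2 (hv i)
  exact ⟨|v i| / 2, by positivity, fun j => by linarith [hi j]⟩

lemma integrable_prod_sinc_mul {n : ℕ} {v : EuclideanSpace ℝ (Fin n)} (hv : ∀ i, v i ≠ 0)
    {S : Finset (Fin n)} (hS : 2 ≤ S.card) {g : ℝ → ℝ} (hg : Measurable g) {C : ℝ}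
    (hC : ∀ t, |g t| ≤ C) : Integrable fun t => (∏ j ∈ S, sinc (v j * t)) * g t := by
  obtain ⟨c, hc, hcv⟩ := exists_pos_lt_abs hv
  refine ((integrable_sinc_majorant hc).mul_const C).mono' ?_ (ae_of_all _ fun t => ?_)
  · have h : Continuous fun t => ∏ j ∈ S, sinc (v j * t) := by fun_prop
    exact (h.measurable.mul hg).aestronglyMeasurable
  · rw [norm_mul, norm_eq_abs, norm_eq_abs]
    exact mul_le_mul (abs_prod_sinc_le hS hc (fun j _ => (hcv j).le) t) (hC t) (abs_nonneg _)
      (by positivity)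

lemma abs_deriv_sinc_mul_le {a c : ℝ} (hc : 0 < c) (ha : c ≤ |a|) (t : ℝ) :
    |deriv sinc (a * t) * t| ≤ 2 / c := by
  rw [le_div_iff₀ hc]
  have h := abs_mul_deriv_sinc_le (a * t)
  have e : a * t * deriv sinc (a * t) = deriv sinc (a * t) * t * a := by ring
  rw [e, abs_mul] at h
  exact (mul_le_mul_of_nonneg_left ha (abs_nonneg _)).trans h

/-- The integrand of the derivative of `sincProdIntegral`. -/
noncomputable def sincProdDeriv {n : ℕ} (v : EuclideanSpace ℝ (Fin n)) (t : ℝ) :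
    EuclideanSpace ℝ (Fin n) →L[ℝ] ℝ :=
  ∑ i, (∏ j ∈ Finset.univ.erase i, sinc (v j * t)) •
    ((deriv sinc (v i * t) * t) • (EuclideanSpace.proj i : EuclideanSpace ℝ (Fin n) →L[ℝ] ℝ))

lemma hasFDerivAt_prod_sinc {n : ℕ} (v : EuclideanSpace ℝ (Fin n)) (t : ℝ) :
    HasFDerivAt (fun v : EuclideanSpace ℝ (Fin n) => ∏ i, sinc (v i * t))
      (sincProdDeriv v t) v := by
  refine HasFDerivAt.finsetProd fun i _ => ?_
  have h1 : HasFDerivAt (fun v : EuclideanSpace ℝ (Fin n) => v i * t)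
      (t • (EuclideanSpace.proj i : EuclideanSpace ℝ (Fin n) →L[ℝ] ℝ)) v :=
    (EuclideanSpace.proj i : EuclideanSpace ℝ (Fin n) →L[ℝ] ℝ).hasFDerivAt.mul_const t
  have h2 := (hasDerivAt_sinc (v i * t)).comp_hasFDerivAt v h1
  rwa [smul_smul] at h2

lemma aestronglyMeasurable_sincProdDeriv {n : ℕ} (v : EuclideanSpace ℝ (Fin n)) :
    AEStronglyMeasurable (sincProdDeriv v) volume := by
  refine Finset.aestronglyMeasurable_fun_sum _ fun i _ => ?_
  have h : Continuous fun t => ∏ j ∈ Finset.univ.erase i, sinc (v j * t) := by fun_prop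
  have h2 : Measurable fun t => deriv sinc (v i * t) * t :=
    ((measurable_deriv sinc).comp (measurable_id.const_mul _)).mul measurable_id
  exact h.aestronglyMeasurable.smul (h2.aestronglyMeasurable.smul_const _)

lemma norm_proj_le {n : ℕ} (i : Fin n) :
    ‖(EuclideanSpace.proj i : EuclideanSpace ℝ (Fin n) →L[ℝ] ℝ)‖ ≤ 1 :=
  ContinuousLinearMap.opNorm_le_bound _ zero_le_one fun x => by
    simpa using PiLp.norm_apply_le x i

lemma card_erase_ge {n : ℕ} (hn : 3 ≤ n) (i : Fin n) :
    2 ≤ ((Finset.univ : Finset (Fin n)).erase i).card := by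
  rw [Finset.card_erase_of_mem (Finset.mem_univ _), Finset.card_univ, Fintype.card_fin]
  omega

lemma norm_sincProdDeriv_le {n : ℕ} (hn : 3 ≤ n) {c : ℝ} (hc : 0 < c)
    {x : EuclideanSpace ℝ (Fin n)} (hx : ∀ i, c < |x i|) (t : ℝ) :
    ‖sincProdDeriv x t‖ ≤ n * (2 * (1 + (c * t) ^ 2)⁻¹ * (2 / c)) := by
  calc ‖sincProdDeriv x t‖ ≤ ∑ _i : Fin n, 2 * (1 + (c * t) ^ 2)⁻¹ * (2 / c) := by
        refine norm_sum_le_of_le _ fun i _ => ?_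
        rw [norm_smul, norm_smul, norm_eq_abs, norm_eq_abs]
        refine mul_le_mul (abs_prod_sinc_le (card_erase_ge hn i) hc (fun j _ => (hx j).le) t) ?_
          (by positivity) (by positivity)
        calc _ ≤ 2 / c * 1 := mul_le_mul (abs_deriv_sinc_mul_le hc (hx i).le t) (norm_proj_le i)
              (norm_nonneg _) (by positivity)
          _ = 2 / c := mul_one _
    _ = _ := by simp

/-- Differentiating one factor gives the bounded function `t sinc'(vᵢ t)`; the at least two
remaining factors supply an integrable majorant, uniform near `v`. -/
lemma hasFDerivAt_sincProdIntegral {n : ℕ} (hn : 3 ≤ n) {v : EuclideanSpace ℝ (Fin n)}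
    (hv : ∀ i, v i ≠ 0) :
    Integrable (sincProdDeriv v) ∧
      HasFDerivAt sincProdIntegral (∫ t, sincProdDeriv v t) v := by
  obtain ⟨c, hc, hcv⟩ := exists_pos_lt_abs hv
  have hbd : Integrable fun t : ℝ => (n : ℝ) * (2 * (1 + (c * t) ^ 2)⁻¹ * (2 / c)) :=
    ((integrable_sinc_majorant hc).mul_const _).const_mul _
  have hs : {x : EuclideanSpace ℝ (Fin n) | ∀ i, c < |x i|} ∈ 𝓝 v := by
    refine eventually_all.2 fun i => ?_
    have : Continuous fun x : EuclideanSpace ℝ (Fin n) => |x i| := by fun_prop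
    exact this.continuousAt.eventually (lt_mem_nhds (hcv i))
  have hmeas : ∀ x : EuclideanSpace ℝ (Fin n),
      AEStronglyMeasurable (fun t => ∏ i, sinc (x i * t)) volume := fun x =>
    Continuous.aestronglyMeasurable (by fun_prop)
  refine ⟨hbd.mono' (aestronglyMeasurable_sincProdDeriv v)
    (ae_of_all _ fun t => norm_sincProdDeriv_le hn hc hcv t), ?_⟩
  refine hasFDerivAt_integral_of_dominated_of_fderiv_le hs (Eventually.of_forall hmeas) ?_
    (aestronglyMeasurable_sincProdDeriv v)
    (ae_of_all _ fun t x hx => norm_sincProdDeriv_le hn hc hx t) hbd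
    (ae_of_all _ fun t x _ => hasFDerivAt_prod_sinc x t)
  have := integrable_prod_sinc_mul hv (S := Finset.univ) (by simp; omega) (g := fun _ => 1)
    measurable_const (C := 1) (by simp)
  simpa using this

/-- `∫ cos(vᵢ t) ∏_{j ≠ i} sinc(vⱼ t) dt`. -/
noncomputable def cosSincProdIntegral {n : ℕ} (v : EuclideanSpace ℝ (Fin n)) (i : Fin n) : ℝ :=
  ∫ t, (∏ j ∈ Finset.univ.erase i, sinc (v j * t)) * cos (v i * t)

lemma integral_sincProdDeriv_apply {n : ℕ} (hn : 3 ≤ n) {v : EuclideanSpace ℝ (Fin n)}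
    (hv : ∀ i, v i ≠ 0) (w : EuclideanSpace ℝ (Fin n)) :
    (∫ t, sincProdDeriv v t) w =
      ∑ i, w i / v i * (cosSincProdIntegral v i - sincProdIntegral v) := by
  rw [ContinuousLinearMap.integral_apply (hasFDerivAt_sincProdIntegral hn hv).1]
  have h1 : ∀ i, Integrable fun t =>
      (∏ j ∈ Finset.univ.erase i, sinc (v j * t)) * cos (v i * t) := fun i =>
    integrable_prod_sinc_mul hv (card_erase_ge hn i) (by fun_prop) (fun _ => abs_cos_le_one _)
  have h2 : Integrable fun t => ∏ j, sinc (v j * t) := by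
    have := integrable_prod_sinc_mul hv (S := Finset.univ) (by simp; omega) (g := fun _ => 1)
      measurable_const (C := 1) (by simp)
    simpa using this
  have e : ∀ t, sincProdDeriv v t w = ∑ i, w i / v i *
      ((∏ j ∈ Finset.univ.erase i, sinc (v j * t)) * cos (v i * t) - ∏ j, sinc (v j * t)) := by
    intro t
    have hp : ∀ i, (EuclideanSpace.proj i : EuclideanSpace ℝ (Fin n) →L[ℝ] ℝ) w = w i :=
      fun _ => rfl
    simp only [sincProdDeriv, sum_apply, smul_apply, hp, smul_eq_mul]
    refine Finset.sum_congr rfl fun i _ => ?_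
    rw [← Finset.prod_erase_mul _ _ (Finset.mem_univ i), ← mul_sub, ← mul_deriv_sinc (v i * t)]
    have hi := hv i
    generalize (∏ j ∈ Finset.univ.erase i, sinc (v j * t)) = q
    generalize deriv sinc (v i * t) = d
    field_simp
  have h3 : ∀ i, Integrable fun t => w i / v i *
      ((∏ j ∈ Finset.univ.erase i, sinc (v j * t)) * cos (v i * t) - ∏ j, sinc (v j * t)) :=
    fun i => ((h1 i).sub h2).const_mul _
  simp only [e]
  rw [integral_finsetSum _ fun i _ => h3 i]
  refine Finset.sum_congr rfl fun i _ => ?_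
  rw [integral_const_mul, integral_sub (h1 i) h2]
  rfl

/-! ### The section volume as a Fourier integral -/

lemma integral_exp_unit_interval (c : ℝ) :
    ∫ x in Icc (-(1 / 2) : ℝ) (1 / 2), Complex.exp (↑(-2 * π * (c * x)) * Complex.I) =
      ((sinc (c * π) : ℝ) : ℂ) := by
  rw [integral_Icc_eq_integral_Ioc, ← intervalIntegral.integral_of_le (by norm_num)]
  by_cases hc : c = 0
  · subst hc
    simp
    norm_num
  have ha : ((-2 * π * c : ℝ) : ℂ) * Complex.I ≠ 0 := by
    refine mul_ne_zero ?_ Complex.I_ne_zero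
    rw [Complex.ofReal_ne_zero]
    exact mul_ne_zero (by simp [pi_ne_zero]) hc
  have e : ∀ x : ℝ, (↑(-2 * π * (c * x)) * Complex.I : ℂ) =
      ((-2 * π * c : ℝ) : ℂ) * Complex.I * x := by
    intro x; push_cast; ring
  simp only [e]
  rw [integral_exp_mul_complex ha, div_eq_iff ha]
  have e1 : ((-2 * π * c : ℝ) : ℂ) * Complex.I * ((1 / 2 : ℝ) : ℂ) =
      -((c * π : ℝ) : ℂ) * Complex.I := by push_cast; ring
  have e2 : ((-2 * π * c : ℝ) : ℂ) * Complex.I * ((-(1 / 2) : ℝ) : ℂ) =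
      ((c * π : ℝ) : ℂ) * Complex.I := by push_cast; ring
  have h := Complex.two_sin ((c * π : ℝ) : ℂ)
  rw [← Complex.ofReal_sin, ← mul_sinc (c * π)] at h
  rw [e1, e2]
  push_cast at h ⊢
  linear_combination Complex.I * h + (Complex.exp (-(c * π) * Complex.I) -
    Complex.exp (c * π * Complex.I)) * Complex.I_sq

/-- The indicator function of the cube. -/
noncomputable def cubeIndicator (n : ℕ) : EuclideanSpace ℝ (Fin n) → ℂ :=
  (cube n).indicator fun _ => 1

lemma isClosed_cube (n : ℕ) : IsClosed (cube n) := by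
  have : cube n = ⋂ i, {x : EuclideanSpace ℝ (Fin n) | x i ∈ Icc (-(1 / 2) : ℝ) (1 / 2)} := by
    ext x; simp [cube]
  rw [this]
  exact isClosed_iInter fun i => isClosed_Icc.preimage (by fun_prop)

lemma norm_le_of_mem_cube {n : ℕ} {x : EuclideanSpace ℝ (Fin n)} (hx : x ∈ cube n) :
    ‖x‖ ≤ √n := by
  rw [EuclideanSpace.norm_eq]
  refine sqrt_le_sqrt ?_
  calc ∑ i, ‖x i‖ ^ 2 ≤ ∑ _i : Fin n, (1 : ℝ) := by
        refine Finset.sum_le_sum fun i _ => ?_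
        have h := hx i
        rw [norm_eq_abs, sq_abs]
        nlinarith [h.1, h.2]
    _ = n := by simp

lemma integrable_cubeIndicator (n : ℕ) : Integrable (cubeIndicator n) := by
  refine (integrable_indicator_iff (isClosed_cube n).measurableSet).2 ?_
  have hfin : volume (cube n) < ⊤ :=
    (measure_mono fun x hx => by
      simpa using norm_le_of_mem_cube hx).trans_lt
      (measure_closedBall_lt_top (x := (0 : EuclideanSpace ℝ (Fin n))) (r := √n))
  exact integrableOn_const hfin.ne

/-- Both the exponential and the indicator of the cube factor over the coordinates. -/
lemma integral_exp_cube {n : ℕ} (v : EuclideanSpace ℝ (Fin n)) (ξ : ℝ) :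
    ∫ x, Complex.exp (↑(-2 * π * (inner ℝ v x * ξ)) * Complex.I) * cubeIndicator n x =
      ((∏ i, sinc (v i * (π * ξ)) : ℝ) : ℂ) := by
  have hmp := PiLp.volume_preserving_toLp (Fin n)
  rw [← hmp.integral_comp (MeasurableEquiv.toLp 2 (Fin n → ℝ)).measurableEmbedding]
  have e : ∀ x : Fin n → ℝ, Complex.exp (↑(-2 * π *
      (inner ℝ v (WithLp.toLp 2 x) * ξ)) * Complex.I) *
      cubeIndicator n (WithLp.toLp 2 x) = ∏ i, (Icc (-(1 / 2) : ℝ) (1 / 2)).indicator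
        (fun y => Complex.exp (↑(-2 * π * (v i * ξ * y)) * Complex.I)) (x i) := by
    intro x
    by_cases hx : WithLp.toLp 2 x ∈ cube n
    · have hx' : ∀ i, x i ∈ Icc (-(1 / 2) : ℝ) (1 / 2) := hx
      rw [cubeIndicator, indicator_of_mem hx, mul_one]
      rw [Finset.prod_congr rfl fun i _ => indicator_of_mem (hx' i) _, ← Complex.exp_sum,
        ← Finset.sum_mul]
      congr 2
      rw [PiLp.inner_apply]
      push_cast
      rw [Finset.sum_mul, Finset.mul_sum]
      refine Finset.sum_congr rfl fun i _ => ?_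
      simp
      ring
    · rw [cubeIndicator, indicator_of_notMem hx, mul_zero]
      obtain ⟨i, hi⟩ : ∃ i, x i ∉ Icc (-(1 / 2) : ℝ) (1 / 2) := by
        by_contra! h
        exact hx h
      exact (Finset.prod_eq_zero (Finset.mem_univ i) (indicator_of_notMem hi _)).symm
  simp only [e]
  rw [integral_fintype_prod_volume_eq_prod (𝕜 := ℂ) (fun i : Fin n =>
    (Icc (-(1 / 2) : ℝ) (1 / 2)).indicator
      (fun y => Complex.exp (↑(-2 * π * (v i * ξ * y)) * Complex.I))), Complex.ofReal_prod]
  refine Finset.prod_congr rfl fun i _ => ?_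
  rw [integral_indicator measurableSet_Icc, integral_exp_unit_interval]
  congr 2; ring

section Slices

variable {E : Type*} [NormedAddCommGroup E] [InnerProductSpace ℝ E] [FiniteDimensional ℝ E]
  [MeasurableSpace E] [BorelSpace E]

/-- The measurable equivalence `(r, y) ↦ r v + y` from `ℝ × v^⊥` onto the whole space. -/
noncomputable def sliceEquiv (v : E) (hv : ‖v‖ = 1) :
    (ℝ × (Submodule.span ℝ {v})ᗮ) ≃ᵐ E :=
  ((LinearIsometryEquiv.toSpanUnitSingleton v hv).toHomeomorph.toMeasurableEquiv.prodCongr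
    (MeasurableEquiv.refl _)).trans ((Submodule.span ℝ {v}).measurableEquivProd (0 : E)).symm

lemma sliceEquiv_apply (v : E) (hv : ‖v‖ = 1) (p : ℝ × (Submodule.span ℝ {v})ᗮ) :
    sliceEquiv v hv p = p.1 • v + p.2 := by
  simp [sliceEquiv]
  rfl

lemma measurePreserving_sliceEquiv (v : E) (hv : ‖v‖ = 1) :
    MeasurePreserving (sliceEquiv v hv) := by
  have h1 := ((Submodule.span ℝ {v}).measurePreserving_measurableEquivProd (0 : E)).symm
  rw [InnerProductSpace.euclideanHausdorffMeasure_eq_volume] at h1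
  have h2 : MeasurePreserving (LinearIsometryEquiv.toSpanUnitSingleton (𝕜 := ℝ) v hv) :=
    (LinearIsometryEquiv.toSpanUnitSingleton v hv).measurePreserving
  exact h1.comp (h2.prod (MeasurePreserving.id volume))

end Slices

/-- The volume of the section of the cube by the hyperplane at signed distance `r` from the
origin. -/
noncomputable def sliceVolume {n : ℕ} (v : EuclideanSpace ℝ (Fin n)) (r : ℝ) : ℂ :=
  ∫ y : (Submodule.span ℝ {v})ᗮ, cubeIndicator n (r • v + y)

lemma integrable_cubeIndicator_slice {n : ℕ} {v : EuclideanSpace ℝ (Fin n)} (hv : ‖v‖ = 1) :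
    Integrable fun p : ℝ × (Submodule.span ℝ {v})ᗮ => cubeIndicator n (p.1 • v + p.2) := by
  have h := ((measurePreserving_sliceEquiv v hv).integrable_comp_emb
    (sliceEquiv v hv).measurableEmbedding).2 (integrable_cubeIndicator n)
  refine h.congr (ae_of_all _ fun p => ?_)
  rw [Function.comp_apply, sliceEquiv_apply]

lemma integrable_sliceVolume {n : ℕ} {v : EuclideanSpace ℝ (Fin n)} (hv : ‖v‖ = 1) :
    Integrable (sliceVolume v) :=
  (integrable_cubeIndicator_slice hv).integral_prod_left

lemma inner_slice {n : ℕ} {v : EuclideanSpace ℝ (Fin n)} (hv : ‖v‖ = 1) (r : ℝ)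
    (y : (Submodule.span ℝ {v})ᗮ) : inner ℝ v (r • v + (y : EuclideanSpace ℝ (Fin n))) = r := by
  have h : inner ℝ v (y : EuclideanSpace ℝ (Fin n)) = 0 :=
    Submodule.mem_orthogonal_singleton_iff_inner_right.1 y.2
  rw [inner_add_right, h, real_inner_smul_right, real_inner_self_eq_norm_sq, hv]
  simp

/-- Fourier slice theorem: by Fubini along `ℝ v ⊕ v^⊥`, this is the transform of the cube on the
line `ℝ v`. -/
lemma fourier_sliceVolume {n : ℕ} {v : EuclideanSpace ℝ (Fin n)} (hv : ‖v‖ = 1) (ξ : ℝ) :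
    FourierTransform.fourier (sliceVolume v) ξ = ((∏ i, sinc (v i * (π * ξ)) : ℝ) : ℂ) := by
  rw [Real.fourier_eq', ← integral_exp_cube,
    ← (measurePreserving_sliceEquiv v hv).integral_comp (sliceEquiv v hv).measurableEmbedding]
  have hi : Integrable fun p : ℝ × (Submodule.span ℝ {v})ᗮ =>
      Complex.exp (↑(-2 * π * (p.1 * ξ)) * Complex.I) * cubeIndicator n (p.1 • v + p.2) := by
    refine (integrable_cubeIndicator_slice hv).bdd_mul (c := 1)
      (Continuous.aestronglyMeasurable (by fun_prop)) (ae_of_all _ fun p => ?_)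
    rw [Complex.norm_exp_ofReal_mul_I]
  have e : ∀ p : ℝ × (Submodule.span ℝ {v})ᗮ,
      Complex.exp (↑(-2 * π * (inner ℝ v (sliceEquiv v hv p) * ξ)) * Complex.I) *
        cubeIndicator n (sliceEquiv v hv p) =
      Complex.exp (↑(-2 * π * (p.1 * ξ)) * Complex.I) * cubeIndicator n (p.1 • v + p.2) := by
    intro p
    rw [sliceEquiv_apply, inner_slice hv]
  simp only [e]
  rw [Measure.volume_eq_prod, integral_prod _ hi]
  refine integral_congr_ae (ae_of_all _ fun r => ?_)
  simp only [integral_const_mul, smul_eq_mul, sliceVolume]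
  congr 4
  simp [mul_comm]

lemma ae_coord_ne {n : ℕ} (hn : 2 ≤ n) {v : EuclideanSpace ℝ (Fin n)} (hv : ∀ i, v i ≠ 0)
    (i : Fin n) (s : ℝ) :
    ∀ᵐ y : (Submodule.span ℝ {v})ᗮ, (y : EuclideanSpace ℝ (Fin n)) i ≠ s := by
  set l : (Submodule.span ℝ {v})ᗮ →ₗ[ℝ] ℝ :=
    (EuclideanSpace.proj i : EuclideanSpace ℝ (Fin n) →L[ℝ] ℝ).toLinearMap ∘ₗ
      (Submodule.span ℝ {v})ᗮ.subtype with hl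
  have hla : ∀ y, l y = (y : EuclideanSpace ℝ (Fin n)) i := fun _ => rfl
  have hker : LinearMap.ker l ≠ ⊤ := by
    obtain ⟨j, hj⟩ : ∃ j : Fin n, j ≠ i := by
      have : Nontrivial (Fin n) := Fin.nontrivial_iff_two_le.2 hn
      exact exists_ne i
    -- A vector orthogonal to `v` with `i`-th coordinate `v j ≠ 0`, showing that the coordinate
    -- functional does not vanish on `v^⊥`.
    set z : EuclideanSpace ℝ (Fin n) :=
      v j • EuclideanSpace.single i 1 - v i • EuclideanSpace.single j 1 with hz
    have hzm : z ∈ (Submodule.span ℝ {v})ᗮ := by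
      rw [Submodule.mem_orthogonal_singleton_iff_inner_right, hz, inner_sub_right,
        real_inner_smul_right, real_inner_smul_right, EuclideanSpace.inner_single_right,
        EuclideanSpace.inner_single_right]
      simp
      ring
    intro h
    have h0 : l ⟨z, hzm⟩ = 0 := by
      have : (⟨z, hzm⟩ : (Submodule.span ℝ {v})ᗮ) ∈ LinearMap.ker l := by rw [h]; trivial
      exact this
    rw [hla] at h0
    simp [hz, hj.symm] at h0
    exact hv j h0
  have hnull := Measure.addHaar_submodule
    (volume : Measure (Submodule.span ℝ {v})ᗮ) _ hker
  by_cases hex : ∃ y₀, l y₀ = s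
  · obtain ⟨y₀, hy₀⟩ := hex
    have hset : {y : (Submodule.span ℝ {v})ᗮ | ¬ (y : EuclideanSpace ℝ (Fin n)) i ≠ s} =
        (fun y => y + -y₀) ⁻¹' (LinearMap.ker l : Set (Submodule.span ℝ {v})ᗮ) := by
      ext y
      change (¬ l y ≠ s) ↔ l (y + -y₀) = 0
      rw [map_add, map_neg, hy₀, not_not, ← sub_eq_add_neg, sub_eq_zero]
    rw [ae_iff, hset, measure_preimage_add_right]
    exact hnull
  · refine ae_of_all _ fun y hy => hex ⟨y, hy⟩

/-- Dominated convergence: almost every point of `v^⊥` lies off the hyperplanes carrying the facets,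
and there the indicator is locally constant in `r`. -/
lemma continuousAt_sliceVolume {n : ℕ} (hn : 2 ≤ n) {v : EuclideanSpace ℝ (Fin n)}
    (hv : ∀ i, v i ≠ 0) : ContinuousAt (sliceVolume v) 0 := by
  refine continuousAt_of_dominated
    (bound := (Metric.closedBall (0 : (Submodule.span ℝ {v})ᗮ) √n).indicator fun _ => 1)
    (Eventually.of_forall fun r => ?_) (Eventually.of_forall fun r => ae_of_all _ fun y => ?_)
    ?_ ?_
  · have h1 : Measurable (cubeIndicator n) :=
      measurable_const.indicator (isClosed_cube n).measurableSet
    have h2 : Continuous fun y : (Submodule.span ℝ {v})ᗮ =>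
      r • v + (y : EuclideanSpace ℝ (Fin n)) := by fun_prop
    exact (h1.comp h2.measurable).aestronglyMeasurable
  · by_cases hmem : r • v + (y : EuclideanSpace ℝ (Fin n)) ∈ cube n
    · have h1 := norm_le_of_mem_cube hmem
      have h0 : inner ℝ (r • v) (y : EuclideanSpace ℝ (Fin n)) = 0 := by
        rw [real_inner_smul_left, Submodule.mem_orthogonal_singleton_iff_inner_right.1 y.2,
          mul_zero]
      have h2 := norm_add_sq_eq_norm_sq_add_norm_sq_of_inner_eq_zero _ _ h0
      have h3 : ‖y‖ ≤ √n := by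
        refine le_trans ?_ h1
        have h4 : ‖y‖ = ‖(y : EuclideanSpace ℝ (Fin n))‖ := rfl
        rw [h4]
        refine le_of_sq_le_sq ?_ (norm_nonneg _)
        nlinarith [mul_self_nonneg ‖r • v‖]
      rw [indicator_of_mem (by simpa using h3), cubeIndicator, indicator_of_mem hmem]
      simp
    · rw [cubeIndicator, indicator_of_notMem hmem, norm_zero]
      exact indicator_nonneg (fun _ _ => zero_le_one) _
  · exact (integrable_indicator_iff measurableSet_closedBall).2
      (integrableOn_const measure_closedBall_lt_top.ne)
  · have hae : ∀ᵐ y : (Submodule.span ℝ {v})ᗮ, ∀ i,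
        (y : EuclideanSpace ℝ (Fin n)) i ≠ 1 / 2 ∧
          (y : EuclideanSpace ℝ (Fin n)) i ≠ -(1 / 2) :=
      ae_all_iff.2 fun i => (ae_coord_ne hn hv i _).and (ae_coord_ne hn hv i _)
    filter_upwards [hae] with y hy
    have hc : ∀ i, ContinuousAt
        (fun r : ℝ => (r • v + (y : EuclideanSpace ℝ (Fin n))) i) 0 := fun i =>
      Continuous.continuousAt (by fun_prop)
    have h0 : ∀ i, ((0 : ℝ) • v + (y : EuclideanSpace ℝ (Fin n))) i =
        (y : EuclideanSpace ℝ (Fin n)) i := fun i => by simp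
    by_cases hmem : (y : EuclideanSpace ℝ (Fin n)) ∈ cube n
    · have hev : ∀ᶠ r : ℝ in 𝓝 0, r • v + (y : EuclideanSpace ℝ (Fin n)) ∈ cube n := by
        refine eventually_all.2 fun i => ?_
        have hi : (y : EuclideanSpace ℝ (Fin n)) i ∈ Ioo (-(1 / 2) : ℝ) (1 / 2) :=
          ⟨lt_of_le_of_ne (hmem i).1 (hy i).2.symm, lt_of_le_of_ne (hmem i).2 (hy i).1⟩
        have := (hc i).eventually_mem (by rw [h0]; exact isOpen_Ioo.mem_nhds hi)
        exact this.mono fun r hr => Ioo_subset_Icc_self hr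
      refine (continuousAt_const (y := (1 : ℂ))).congr ?_
      filter_upwards [hev] with r hr
      rw [cubeIndicator, indicator_of_mem hr]
    · obtain ⟨i, hi⟩ : ∃ i, (y : EuclideanSpace ℝ (Fin n)) i ∉ Icc (-(1 / 2) : ℝ) (1 / 2) := by
        by_contra! h
        exact hmem h
      have hev : ∀ᶠ r : ℝ in 𝓝 0, r • v + (y : EuclideanSpace ℝ (Fin n)) ∉ cube n := by
        have := (hc i).eventually_mem (by rw [h0]; exact isClosed_Icc.isOpen_compl.mem_nhds hi)
        exact this.mono fun r hr hr2 => hr (hr2 i)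
      refine (continuousAt_const (y := (0 : ℂ))).congr ?_
      filter_upwards [hev] with r hr
      rw [cubeIndicator, indicator_of_notMem hr]

lemma sliceVolume_zero {n : ℕ} (hn : 1 ≤ n) {v : EuclideanSpace ℝ (Fin n)} (hv : ‖v‖ = 1) :
    sliceVolume v 0 = (sectionVolume v : ℂ) := by
  set T : Set (Submodule.span ℝ {v})ᗮ := {y | (y : EuclideanSpace ℝ (Fin n)) ∈ cube n} with hT
  have hTm : MeasurableSet T :=
    ((isClosed_cube n).preimage continuous_subtype_val).measurableSet
  have h1 : centralSection v = Subtype.val '' T := by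
    ext x
    simp [centralSection, hT, and_comm]
  have hrank : Module.finrank ℝ (Submodule.span ℝ {v})ᗮ = n - 1 := by
    have : Fact (Module.finrank ℝ (EuclideanSpace ℝ (Fin n)) = n - 1 + 1) :=
      ⟨by rw [finrank_euclideanSpace_fin]; omega⟩
    refine Submodule.finrank_orthogonal_span_singleton (norm_ne_zero_iff.1 ?_)
    rw [hv]; exact one_ne_zero
  -- The normalised Hausdorff measure is Lebesgue measure on `v^⊥` because `n - 1` is exactly its
  -- dimension.
  have h2 : (μHE[n - 1] : Measure (Submodule.span ℝ {v})ᗮ) = volume := by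
    rw [← hrank]; exact InnerProductSpace.euclideanHausdorffMeasure_eq_volume
  rw [sectionVolume, h1, isometry_subtype_coe.euclideanHausdorffMeasure_image, h2]
  have h3 : ∀ y : (Submodule.span ℝ {v})ᗮ,
      cubeIndicator n ((0 : ℝ) • v + y) = T.indicator (fun _ => (1 : ℂ)) y := by
    intro y
    rw [zero_smul, zero_add, cubeIndicator]
    rfl
  simp only [sliceVolume, h3]
  rw [integral_indicator hTm, setIntegral_const]
  simp [Measure.real]

/-- The volume of a central section orthogonal to a unit vector without zero coordinates. -/
theorem sectionVolume_eq {n : ℕ} (hn : 2 ≤ n) {v : EuclideanSpace ℝ (Fin n)} (hv1 : ‖v‖ = 1)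
    (hv : ∀ i, v i ≠ 0) : sectionVolume v = π⁻¹ * sincProdIntegral v := by
  have hI : Integrable fun ξ : ℝ => ((∏ i, sinc (v i * (π * ξ)) : ℝ) : ℂ) := by
    have := integrable_prod_sinc_mul hv (S := Finset.univ) (by simpa using hn) (g := fun _ => 1)
      measurable_const (C := 1) (by simp)
    simp only [mul_one] at this
    exact (this.comp_mul_left' pi_ne_zero).ofReal
  have hf : FourierTransform.fourier (sliceVolume v) =
      fun ξ : ℝ => ((∏ i, sinc (v i * (π * ξ)) : ℝ) : ℂ) :=
    funext fun ξ => fourier_sliceVolume hv1 ξ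
  -- Pointwise inversion needs continuity only at `0`, besides integrability of the function and its
  -- transform.
  have h := (integrable_sliceVolume hv1).fourierInv_fourier_eq (by rw [hf]; exact hI)
    (continuousAt_sliceVolume hn hv)
  rw [sliceVolume_zero (by omega) hv1, hf, Real.fourierInv_eq'] at h
  simp only [inner_zero_right, mul_zero, Complex.ofReal_zero, zero_mul, Complex.exp_zero,
    one_smul] at h
  rw [integral_complex_ofReal, Complex.ofReal_inj,
    Measure.integral_comp_mul_left (fun t => ∏ i, sinc (v i * t)) π,
    abs_of_pos (by positivity), smul_eq_mul] at h
  exact h.symm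

/-! ### Critical directions with two distinct coordinates -/

/-- Under these equations the differential of the integral at `v` is a multiple of `⟨v, ·⟩`, hence
zero on `v^⊥`. The integral formula for the volume is used only on the sphere near `v`. -/
lemma isCriticalDirection_of_cosSincProdIntegral {n : ℕ} (hn : 3 ≤ n)
    {v : EuclideanSpace ℝ (Fin n)} (hv1 : ‖v‖ = 1) (hv : ∀ i, v i ≠ 0)
    (hcrit : ∀ i, cosSincProdIntegral v i = (1 - v i ^ 2) * sincProdIntegral v) :
    IsCriticalDirection v := by
  refine ⟨by simpa using hv1, π⁻¹ • ∫ t, sincProdDeriv v t, ?_, fun w hw => ?_⟩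
  · have h := ((hasFDerivAt_sincProdIntegral hn hv).2.const_mul π⁻¹).hasFDerivWithinAt
      (s := Metric.sphere 0 1)
    have hev : ∀ᶠ x : EuclideanSpace ℝ (Fin n) in 𝓝 v, ∀ i, x i ≠ 0 := by
      refine eventually_all.2 fun i => ?_
      have hc : Continuous fun x : EuclideanSpace ℝ (Fin n) => x i := by fun_prop
      exact hc.continuousAt.eventually_ne (hv i)
    refine h.congr_of_eventuallyEq ?_ (sectionVolume_eq (by omega) hv1 hv)
    filter_upwards [mem_nhdsWithin_of_mem_nhds hev, self_mem_nhdsWithin] with x hx hx1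
    exact sectionVolume_eq (by omega) (by simpa using hx1) hx
  · have hw' : inner ℝ v w = 0 := Submodule.mem_orthogonal_singleton_iff_inner_right.1 hw
    rw [PiLp.inner_apply] at hw'
    rw [smul_apply, integral_sincProdDeriv_apply hn hv]
    have e : ∀ i, w i / v i * (cosSincProdIntegral v i - sincProdIntegral v) =
        -sincProdIntegral v * inner ℝ (v i) (w i) := by
      intro i
      rw [hcrit i]
      have := hv i
      simp
      field_simp
      ring
    simp only [e]
    rw [← Finset.mul_sum, hw']
    simp

/-! ### Products and norm for `(a, a, b, …, b)` -/

lemma card_filter_lt_two {n : ℕ} (hn : 2 ≤ n) :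
    (Finset.univ.filter fun j : Fin n => (j : ℕ) < 2).card = 2 := by
  obtain ⟨m, rfl⟩ := Nat.exists_eq_add_of_le' hn
  rw [Finset.card_filter, Fin.sum_univ_succ, Fin.sum_univ_succ]
  simp

lemma card_filter_not_lt_two {n : ℕ} (hn : 2 ≤ n) :
    (Finset.univ.filter fun j : Fin n => ¬ (j : ℕ) < 2).card = n - 2 := by
  have h := Finset.card_filter_add_card_filter_not (s := (Finset.univ : Finset (Fin n)))
    (fun j : Fin n => (j : ℕ) < 2)
  rw [card_filter_lt_two hn, Finset.card_univ, Fintype.card_fin] at h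
  omega

lemma prod_ite_lt_two {n : ℕ} (hn : 2 ≤ n) (p q : ℝ) :
    ∏ j : Fin n, (if (j : ℕ) < 2 then p else q) = p ^ 2 * q ^ (n - 2) := by
  rw [Finset.prod_ite, Finset.prod_const, Finset.prod_const, card_filter_lt_two hn,
    card_filter_not_lt_two hn]

lemma prod_erase_ite_lt_two {n : ℕ} (hn : 2 ≤ n) (p q : ℝ) {i : Fin n} (hi : (i : ℕ) < 2) :
    ∏ j ∈ Finset.univ.erase i, (if (j : ℕ) < 2 then p else q) = p * q ^ (n - 2) := by
  rw [Finset.prod_ite, Finset.prod_const, Finset.prod_const, Finset.filter_erase,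
    Finset.filter_erase, Finset.card_erase_of_mem (by simpa using hi),
    Finset.erase_eq_of_notMem (by simpa using hi), card_filter_lt_two hn,
    card_filter_not_lt_two hn]
  simp

lemma prod_erase_ite_not_lt_two {n : ℕ} (hn : 2 ≤ n) (p q : ℝ) {i : Fin n} (hi : ¬ (i : ℕ) < 2) :
    ∏ j ∈ Finset.univ.erase i, (if (j : ℕ) < 2 then p else q) = p ^ 2 * q ^ (n - 2 - 1) := by
  rw [Finset.prod_ite, Finset.prod_const, Finset.prod_const, Finset.filter_erase,
    Finset.filter_erase, Finset.erase_eq_of_notMem (by simpa using hi),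
    Finset.card_erase_of_mem (by simpa using hi), card_filter_lt_two hn,
    card_filter_not_lt_two hn]

lemma twoValued_apply (n k : ℕ) (a : ℝ) (i : Fin n) :
    twoValued n k a i = if (i : ℕ) < k then a else bCoord n k a := rfl

lemma sinc_twoValued (n : ℕ) (a t : ℝ) (i : Fin n) :
    sinc (twoValued n 2 a i * t) =
      if (i : ℕ) < 2 then sinc (a * t) else sinc (bCoord n 2 a * t) := by
  rw [twoValued_apply]; split_ifs <;> rfl

lemma norm_twoValued {n : ℕ} (hn : 3 ≤ n) {a : ℝ} (ha : 2 * a ^ 2 ≤ 1) :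
    ‖twoValued n 2 a‖ = 1 := by
  have hn' : (0 : ℝ) < n - 2 := by
    have : (3 : ℝ) ≤ n := by exact_mod_cast hn
    linarith
  have hb : bCoord n 2 a ^ 2 = (1 - 2 * a ^ 2) / (n - 2) := by
    rw [bCoord, sq_sqrt (div_nonneg (by push_cast; linarith) (by push_cast; linarith))]
    push_cast; rfl
  rw [EuclideanSpace.norm_eq, sqrt_eq_one]
  have e : ∀ i : Fin n, ‖twoValued n 2 a i‖ ^ 2 =
      if (i : ℕ) < 2 then a ^ 2 else bCoord n 2 a ^ 2 := by
    intro i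
    rw [twoValued_apply, norm_eq_abs, sq_abs]
    split_ifs <;> rfl
  simp only [e]
  rw [Finset.sum_ite, Finset.sum_const, Finset.sum_const, card_filter_lt_two (by omega),
    card_filter_not_lt_two (by omega), nsmul_eq_mul, nsmul_eq_mul, hb,
    Nat.cast_sub (by omega)]
  field_simp
  push_cast
  ring

/-- All non-zero coordinates of a diagonal vector have the same absolute value; compare the first
and the third. -/
lemma not_isDiagonal_twoValued {n : ℕ} (hn : 3 ≤ n) {a : ℝ} (ha : 0 < a)
    (hb : 0 < bCoord n 2 a) (hab : a ≠ bCoord n 2 a) : ¬ IsDiagonal (twoValued n 2 a) := by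
  rintro ⟨k, -, -, p, q, hp, hq, -, c, -, hv⟩
  have habs : ∀ i, twoValued n 2 a i ≠ 0 → |twoValued n 2 a i| = |c| := by
    intro i hi
    have h : twoValued n 2 a i = c * (q i - p i) := by rw [hv]; simp
    rw [h] at hi ⊢
    have hd : |q i - p i| = 1 ∨ q i - p i = 0 := by
      rcases hp i with h1 | h1 <;> rcases hq i with h2 | h2 <;> rw [h1, h2] <;> norm_num
    rcases hd with hd | hd
    · rw [abs_mul, hd, mul_one]
    · rw [hd, mul_zero] at hi
      exact absurd rfl hi
  have h0 : twoValued n 2 a ⟨0, by omega⟩ = a := by simp [twoValued_apply]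
  have h2 : twoValued n 2 a ⟨2, by omega⟩ = bCoord n 2 a := by simp [twoValued_apply]
  have e0 := habs ⟨0, by omega⟩ (by rw [h0]; exact ha.ne')
  have e2 := habs ⟨2, by omega⟩ (by rw [h2]; exact hb.ne')
  rw [h0, abs_of_pos ha] at e0
  rw [h2, abs_of_pos hb] at e2
  exact hab (e0.trans e2.symm)

lemma integral_comp_scale (g : ℝ → ℝ) {b : ℝ} (hb : 0 < b) :
    ∫ t, g (b * t) = b⁻¹ * ∫ t, g t := by
  rw [Measure.integral_comp_mul_left g b, abs_of_pos (inv_pos.2 hb), smul_eq_mul]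

/-- There is a critical direction `(a, a, b, …, b)` with `a > b > 0`. -/
theorem exists_twoValued_isCriticalDirection (n : ℕ) (hn : 4 ≤ n) :
    ∃ ξ ∈ Ioo (1 / √(n : ℝ)) (1 / √(2 : ℝ)), F n 2 ξ = 0 ∧
      IsCriticalDirection (twoValued n 2 ξ) ∧ ¬ IsDiagonal (twoValued n 2 ξ) ∧
      ∀ i : Fin n, twoValued n 2 ξ i ≠ 0 := by
  obtain ⟨k, rfl⟩ : ∃ k, n = k + 1 + 2 := ⟨n - 3, by omega⟩
  obtain ⟨x, hx1, hx⟩ := exists_critical_ratio (m := k + 1) (by omega)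
  have hx0 : 0 < x := zero_lt_one.trans hx1
  have heuler := euler_relation k hx0.ne'
  set volI := ∫ t, sinc (x * t) ^ 2 * sinc t ^ (k + 1) with hvolI
  set cosA := ∫ t, sinc (x * t) * cos (x * t) * sinc t ^ (k + 1) with hcosA
  set cosB := ∫ t, sinc t ^ k * cos t * sinc (x * t) ^ 2 with hcosB
  push_cast at hx
  have hk : (0 : ℝ) < k + 1 := by positivity
  have hQ : 0 < 2 * x ^ 2 + ((k : ℝ) + 1) := by positivity
  -- Normalises `(x, x, 1, …, 1)`, which has `n - 2 = k + 1` ones; thus `a = x b`.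
  set b : ℝ := 1 / √(2 * x ^ 2 + ((k : ℝ) + 1)) with hb
  have hb0 : 0 < b := by positivity
  have hb2 : b ^ 2 = 1 / (2 * x ^ 2 + ((k : ℝ) + 1)) := by
    rw [hb, div_pow, sq_sqrt hQ.le, one_pow]
  have ha2 : (x * b) ^ 2 = x ^ 2 / (2 * x ^ 2 + ((k : ℝ) + 1)) := by
    rw [mul_pow, hb2]; ring
  have hbc : bCoord (k + 1 + 2) 2 (x * b) = b := by
    rw [bCoord, ha2, ← sqrt_sq hb0.le, hb2]
    congr 1
    push_cast
    field_simp
    ring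
  have h1a : 1 - (x * b) ^ 2 = (x ^ 2 + ((k : ℝ) + 1)) / (2 * x ^ 2 + ((k : ℝ) + 1)) := by
    rw [ha2]; field_simp; ring
  have h1b : 1 - b ^ 2 = (2 * x ^ 2 + k) / (2 * x ^ 2 + ((k : ℝ) + 1)) := by
    rw [hb2]; field_simp; ring
  have hA : cosA = (1 - (x * b) ^ 2) * volI := by
    rw [h1a, div_mul_eq_mul_div, eq_div_iff hQ.ne']; linarith
  -- The second critical equation follows from the first: `2 cosA + (k+1) cosB = (k+2) volI` by
  -- `euler_relation`, and `2(1 - a²) + (k+1)(1 - b²) = k + 2`.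
  have hB : cosB = (1 - b ^ 2) * volI := by
    rw [h1b, div_mul_eq_mul_div, eq_div_iff hQ.ne']
    refine mul_left_cancel₀ hk.ne' ?_
    linear_combination (2 * x ^ 2 + ((k : ℝ) + 1)) * heuler - 2 * hx
  have hpos : ∀ i, 0 < twoValued (k + 1 + 2) 2 (x * b) i := by
    intro i
    rw [twoValued_apply, hbc]
    split_ifs <;> positivity
  have hnorm : ‖twoValued (k + 1 + 2) 2 (x * b)‖ = 1 := by
    refine norm_twoValued (by omega) ?_
    rw [ha2, ← mul_div_assoc, div_le_one hQ]
    linarith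
  have hI : sincProdIntegral (twoValued (k + 1 + 2) 2 (x * b)) = b⁻¹ * volI := by
    rw [hvolI, ← integral_comp_scale _ hb0, sincProdIntegral]
    simp only [sinc_twoValued, prod_ite_lt_two (show 2 ≤ k + 1 + 2 by omega), hbc, mul_assoc,
      Nat.add_sub_cancel]
  have hAi : ∀ t, sinc (b * t) ^ (k + 1) * sinc (x * b * t) * cos (x * b * t) =
      (fun t => sinc (x * t) * cos (x * t) * sinc t ^ (k + 1)) (b * t) := by
    intro t; simp only [mul_assoc]; ring
  have hBi : ∀ t, sinc (b * t) ^ k * sinc (x * b * t) ^ 2 * cos (b * t) =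
      (fun t => sinc t ^ k * cos t * sinc (x * t) ^ 2) (b * t) := by
    intro t; simp only [mul_assoc]; ring
  have hIA : ∫ t, sinc (b * t) ^ (k + 1) * sinc (x * b * t) * cos (x * b * t) =
      b⁻¹ * cosA := by
    exact (integral_congr_ae (ae_of_all _ hAi)).trans (integral_comp_scale
      (fun t => sinc (x * t) * cos (x * t) * sinc t ^ (k + 1)) hb0)
  have hIB : ∫ t, sinc (b * t) ^ k * sinc (x * b * t) ^ 2 * cos (b * t) =
      b⁻¹ * cosB := by
    exact (integral_congr_ae (ae_of_all _ hBi)).trans (integral_comp_scale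
      (fun t => sinc t ^ k * cos t * sinc (x * t) ^ 2) hb0)
  have h1a0 : 0 < 1 - (x * b) ^ 2 := by rw [h1a]; positivity
  have h1b0 : 0 < 1 - b ^ 2 := by rw [h1b]; positivity
  refine ⟨x * b, ⟨?_, ?_⟩, ?_, ?_, ?_, fun i => (hpos i).ne'⟩
  · rw [← sq_lt_sq₀ (by positivity) (by positivity), ha2, div_pow, sq_sqrt (by positivity),
      one_pow, div_lt_div_iff₀ (by positivity) hQ]
    push_cast
    nlinarith [mul_pos hk (show 0 < x ^ 2 - 1 by nlinarith)]
  · rw [← sq_lt_sq₀ (by positivity) (by positivity), ha2, div_pow, sq_sqrt (by positivity),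
      one_pow, div_lt_div_iff₀ hQ (by positivity)]
    linarith
  · simp only [F, hbc, Nat.add_sub_cancel, Nat.add_one_sub_one, pow_one]
    rw [hIA, hIB, hA, hB]
    have hcancel : ∀ c : ℝ, 0 < c → 1 / (π * c) * (b⁻¹ * (c * volI)) = b⁻¹ * volI / π := by
      intro c hc
      have := pi_pos
      field_simp
    rw [hcancel _ h1a0, hcancel _ h1b0, sub_self]
  · refine isCriticalDirection_of_cosSincProdIntegral (by omega) hnorm (fun i => (hpos i).ne')
      fun i => ?_
    rw [hI, cosSincProdIntegral, twoValued_apply]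
    simp only [sinc_twoValued]
    by_cases hi : (i : ℕ) < 2
    · simp only [prod_erase_ite_lt_two (show 2 ≤ k + 1 + 2 by omega) _ _ hi, if_pos hi, hbc,
        Nat.add_sub_cancel]
      rw [← mul_left_comm, ← hA, ← hIA]
      congr 1; ext t; ring
    · simp only [prod_erase_ite_not_lt_two (show 2 ≤ k + 1 + 2 by omega) _ _ hi, if_neg hi, hbc,
        Nat.add_sub_cancel]
      rw [← mul_left_comm, ← hB, ← hIB]
      congr 1; ext t; ring
  · refine not_isDiagonal_twoValued (by omega) (by positivity) (by rwa [hbc]) ?_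
    rw [hbc]
    exact (lt_mul_of_one_lt_left hb0 hx1).ne'

end CubeSections

theorem theorem2 (n : ℕ) (hn : 4 ≤ n) :
    ∃ ξ ∈ Set.Ioo (1 / √(n : ℝ)) (1 / √(2 : ℝ)),
      CubeSections.F n 2 ξ = 0 ∧
      CubeSections.IsCriticalDirection (CubeSections.twoValued n 2 ξ) ∧
      ¬ CubeSections.IsDiagonal (CubeSections.twoValued n 2 ξ) ∧
      ∀ i : Fin n, CubeSections.twoValued n 2 ξ i ≠ 0 :=
  CubeSections.exists_twoValued_isCriticalDirection n hn
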